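/- Fix an integer $k\ge 0$. There are a single real-RAM program (unit-cost comparisons and operations $+,-,\times,/$ on real numbers, rational constants only, no rounding; natural-number index registers with addition, truncated subtraction and comparison at unit cost; indirect addressing) and a polynomial $T$, both depending only on $k$, such that the following holds for every finite simple graph $G$ on $n$ vertices that is $k$-partially walk-regular (i.e. for each $\ell=0,\dots,k$ the number of closed walks of length $\ell$ rooted at a vertex $v$ does not depend on $v$). Let $\lambda_1\ge\dots\ge\lambda_n$ be the adjacency eigenvalues of $G$, let $\theta_0>\dots>\theta_d$ be the distinct ones, and let $m_0,\dots,m_d$ be their multiplicities. For a real polynomial $p$ put $n_+(p)=|\{i:p(\lambda_i)>0\}|$ and $n_-(p)=|\{i:p(\lambda_i)<0\}|$. Call $p$ admissible if $\deg p\le k$, $\sum_{i=1}^n p(\lambda_i)=0$ and $n_+(p)\neq 0$. The problem $\textsc{Poly-Inertia}_\chi(G,k)$ is to compute $$\nu_k(G)=\max_{p\ \text{admissible}}\left(1+\frac{n_-(p)}{n_+(p)}\right).$$ Given as input exactly the result of the spectral preprocessing, that is, the number $d+1$ and the lists $(\theta_0,\dots,\theta_d)$ and $(m_0,\dots,m_d)$,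 the program halts after at most $T(n)$ steps and solves $\textsc{Poly-Inertia}_\chi(G,k)$: it reports that no admissible polynomial exists if that is the case, and otherwise it outputs the value $\nu_k(G)$ (the maximum exists) together with the coefficients of an admissible polynomial of degree at most $k$ attaining it. -/

import Mathlib

namespace PolyInertia

/-! ## The optimization problem -/

section Problem

universe u

variable {V : Type u}

/-- `G` is `k`-partially walk-regular: for every `l ≤ k`, the number of closed walks of length `l`
rooted at `v` does not depend on the vertex `v`. -/
def PartiallyWalkRegular (G : SimpleGraph V) (k : ℕ) : Prop :=
  ∀ l ≤ k, ∀ u v : V,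
    Nat.card {w : G.Walk u u // w.length = l} = Nat.card {w : G.Walk v v // w.length = l}

variable [Fintype V] [DecidableEq V] (G : SimpleGraph V) [DecidableRel G.Adj]

/-- The adjacency eigenvalues of `G`, counted with multiplicity (a family of `n = |V|` reals). -/
noncomputable def eigenvalue : V → ℝ :=
  (show (G.adjMatrix ℝ).IsHermitian from G.isHermitian_adjMatrix ℝ).eigenvalues

/-- The number of eigenvalues, with multiplicity, at which `p` is positive. -/
noncomputable def nPos (p : Polynomial ℝ) : ℕ := Nat.card {i : V // 0 < p.eval (eigenvalue G i)}

/-- The number of eigenvalues, with multiplicity, at which `p` is negative. -/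
noncomputable def nNeg (p : Polynomial ℝ) : ℕ := Nat.card {i : V // p.eval (eigenvalue G i) < 0}

/-- The polynomials over which the problem maximizes: degree at most `k`, trace zero, and not
discarded for having no positive value on the spectrum. -/
def Admissible (k : ℕ) (p : Polynomial ℝ) : Prop :=
  p.degree ≤ k ∧ ∑ i : V, p.eval (eigenvalue G i) = 0 ∧ nPos G p ≠ 0

/-- The objective function. -/
noncomputable def objective (p : Polynomial ℝ) : ℝ := 1 + (nNeg G p : ℝ) / (nPos G p : ℝ)

/-- `ν` is the optimal value `ν_k(G)`: the maximum of the objective over admissible polynomials. -/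
def IsOptimalValue (k : ℕ) (ν : ℝ) : Prop :=
  IsGreatest (objective G '' {p | Admissible G k p}) ν

/-- The distinct eigenvalues, in decreasing order. -/
noncomputable def distinctEigenvalues : List ℝ :=
  (Finset.univ.image (eigenvalue G)).sort (· ≥ ·)

/-- The multiplicity of the real number `x` as an eigenvalue. -/
noncomputable def eigMult (x : ℝ) : ℕ := Nat.card {i : V // eigenvalue G i = x}

end Problem

/-! ## The model of computation: a real RAM

A machine has index registers holding natural numbers, real registers, and a real memory that is
addressed by natural numbers, possibly indirectly. It can compute with the four arithmetic
operations on reals and compare reals; on indices it can add, subtract and compare. Every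
operation has cost one. The only real constants in a program are rational, and there is no way
from a real number to an index (no rounding) except through comparisons.
Programs are structured programs over these operations. -/

structure State where
  idx : ℕ → ℕ
  reg : ℕ → ℝ
  mem : ℕ → ℝ

/-- Index expressions. -/
inductive IExp where
  | const (c : ℕ)
  | var (x : ℕ)
  | add (a b : IExp)
  | sub (a b : IExp)

/-- Real expressions; `load a` reads the memory cell whose address is the value of `a`. -/
inductive RExp where
  | const (q : ℚ)
  | reg (x : ℕ)
  | load (a : IExp)
  | add (a b : RExp)
  | sub (a b : RExp)
  | mul (a b : RExp)
  | div (a b : RExp)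

/-- Tests. -/
inductive Test where
  | idxEq (a b : IExp)
  | idxLt (a b : IExp)
  | realEq (a b : RExp)
  | realLt (a b : RExp)
  | not (t : Test)
  | and (t₁ t₂ : Test)

/-- Programs. -/
inductive Prog where
  | skip
  | setIdx (x : ℕ) (e : IExp)
  | setReg (x : ℕ) (e : RExp)
  | store (a : IExp) (e : RExp)
  | seq (c₁ c₂ : Prog)
  | ite (t : Test) (c₁ c₂ : Prog)
  | while (t : Test) (c : Prog)

/-- Subtraction of indices is truncated at `0`. -/
def IExp.eval (s : State) : IExp → ℕ
  | .const c => c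
  | .var x => s.idx x
  | .add a b => a.eval s + b.eval s
  | .sub a b => a.eval s - b.eval s

def IExp.cost : IExp → ℕ
  | .const _ => 1
  | .var _ => 1
  | .add a b => a.cost + b.cost + 1
  | .sub a b => a.cost + b.cost + 1

/-- Division by `0` returns `0`; a program can test for a zero divisor. -/
noncomputable def RExp.eval (s : State) : RExp → ℝ
  | .const q => (q : ℝ)
  | .reg x => s.reg x
  | .load a => s.mem (a.eval s)
  | .add a b => a.eval s + b.eval s
  | .sub a b => a.eval s - b.eval s
  | .mul a b => a.eval s * b.eval s
  | .div a b => a.eval s / b.eval s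

def RExp.cost : RExp → ℕ
  | .const _ => 1
  | .reg _ => 1
  | .load a => a.cost + 1
  | .add a b => a.cost + b.cost + 1
  | .sub a b => a.cost + b.cost + 1
  | .mul a b => a.cost + b.cost + 1
  | .div a b => a.cost + b.cost + 1

def Test.Holds (s : State) : Test → Prop
  | .idxEq a b => a.eval s = b.eval s
  | .idxLt a b => a.eval s < b.eval s
  | .realEq a b => a.eval s = b.eval s
  | .realLt a b => a.eval s < b.eval s
  | .not t => ¬ t.Holds s
  | .and t₁ t₂ => t₁.Holds s ∧ t₂.Holds s

def Test.cost : Test → ℕ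
  | .idxEq a b => a.cost + b.cost + 1
  | .idxLt a b => a.cost + b.cost + 1
  | .realEq a b => a.cost + b.cost + 1
  | .realLt a b => a.cost + b.cost + 1
  | .not t => t.cost + 1
  | .and t₁ t₂ => t₁.cost + t₂.cost + 1

/-- `Exec c s t s₁`: the program `c`, started in state `s`, halts in state `s₁` after `t` steps. -/
inductive Exec : Prog → State → ℕ → State → Prop
  | skip (s : State) : Exec .skip s 1 s
  | setIdx (x : ℕ) (e : IExp) (s : State) :
      Exec (.setIdx x e) s (e.cost + 1) { s with idx := Function.update s.idx x (e.eval s) }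
  | setReg (x : ℕ) (e : RExp) (s : State) :
      Exec (.setReg x e) s (e.cost + 1) { s with reg := Function.update s.reg x (e.eval s) }
  | store (a : IExp) (e : RExp) (s : State) :
      Exec (.store a e) s (a.cost + e.cost + 1)
        { s with mem := Function.update s.mem (a.eval s) (e.eval s) }
  | seq {c₁ c₂ : Prog} {s s₁ s₂ : State} {t₁ t₂ : ℕ} :
      Exec c₁ s t₁ s₁ → Exec c₂ s₁ t₂ s₂ → Exec (.seq c₁ c₂) s (t₁ + t₂) s₂
  | iteTrue {b : Test} {c₁ c₂ : Prog} {s s₁ : State} {t : ℕ} :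
      b.Holds s → Exec c₁ s t s₁ → Exec (.ite b c₁ c₂) s (b.cost + t + 1) s₁
  | iteFalse {b : Test} {c₁ c₂ : Prog} {s s₁ : State} {t : ℕ} :
      ¬ b.Holds s → Exec c₂ s t s₁ → Exec (.ite b c₁ c₂) s (b.cost + t + 1) s₁
  | whileFalse {b : Test} {c : Prog} {s : State} :
      ¬ b.Holds s → Exec (.while b c) s (b.cost + 1) s
  | whileTrue {b : Test} {c : Prog} {s s₁ s₂ : State} {t₁ t₂ : ℕ} :
      b.Holds s → Exec c s t₁ s₁ → Exec (.while b c) s₁ t₂ s₂ →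
      Exec (.while b c) s (b.cost + t₁ + t₂ + 1) s₂

/-! ## Input and output -/

section InputOutput

universe u

variable {V : Type u} [Fintype V] [DecidableEq V] (G : SimpleGraph V) [DecidableRel G.Adj]

/-- The machine state that holds the result of the spectral preprocessing and nothing else. If
`θ₀ > ⋯ > θ_d` are the distinct eigenvalues and `m₀, …, m_d` their multiplicities, then index
register `0` holds `d + 1`, memory cells `0, …, d` hold the `θ_j`, and memory cells
`d + 1, …, 2 * d + 1` hold the `m_j`. All else is zero. -/
noncomputable def spectralInput : State where
  idx := fun x => if x = 0 then (distinctEigenvalues G).length else 0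
  reg := fun _ => 0
  mem := fun j => (distinctEigenvalues G ++
    (distinctEigenvalues G).map (fun x => (eigMult G x : ℝ))).getD j 0

/-- The polynomial whose coefficients `a₀, …, a_k` stand in the real registers `1, …, k + 1`. -/
noncomputable def outputPoly (k : ℕ) (s : State) : Polynomial ℝ :=
  ∑ i ∈ Finset.range (k + 1), Polynomial.C (s.reg (i + 1)) * Polynomial.X ^ i

/-- The final state `s` solves the problem for `G` and `k`. Either index register `0` holds `0` and
there is no admissible polynomial, or it holds `1`, real register `0` holds the optimal value and
the output polynomial is admissible and attains it. -/
def SolvesPolyInertia (k : ℕ) (s : State) : Prop :=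
  (s.idx 0 = 0 ∧ ∀ p, ¬ Admissible G k p) ∨
  (s.idx 0 = 1 ∧ IsOptimalValue G k (s.reg 0) ∧
    Admissible G k (outputPoly k s) ∧ objective G (outputPoly k s) = s.reg 0)

end InputOutput

end PolyInertia

/-! Only the signs of `p` on the set `Θ` of distinct eigenvalues and the linear condition that the
trace vanishes matter. The polynomials of degree at most `k` whose signs on `Θ` agree with those of
`p`, zeros being allowed anywhere, form a cone, and its generators are simple. If `p` has fewer than
`k` zeros in `Θ` and is nonzero at two points of `Θ`, then it lies strictly between two members of
the cone with more zeros (`exists_split`). After at most `k` rounds every piece has `k` zeros in `Θ`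
or at most one nonzero value there, so on `Θ` it is a positive multiple of an elementary polynomial,
given by `k + 2` points of `Θ` (`exists_elementary`). Hence `p` is on `Θ` a positive combination of
`2 ^ k` such polynomials (`exists_conformal_decomposition`). Nothing cancels in it, so any other
positive weights give the same signs (`sign_of_conformal`).

The freedom in the weights removes all unknown reals. Let `U` be the sum of the pieces of
nonnegative trace and `W` the sum of the others. Since a positive combination of the traces
vanishes, either all traces vanish and `U` is the sum of all pieces, or `tr U > 0 > tr W`. In the
second case `tr U • W - tr W • U` has trace zero and positive weights. So each sign pattern of an
admissible polynomial is that of a candidate given by `2 * 2 ^ k * (k + 2)` indices below `d + 1`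
(`exists_candidate`). For fixed `k` there are polynomially many of these index vectors, and nested
loops try them all (`Runs.nest`, `searchProg_runs`). -/

namespace PolyInertia

open Polynomial

/-! ### Conformal decomposition into elementary polynomials -/

section Conformal

/-- `q` is conformal to `p` on `Θ`: wherever `q` is nonzero, `p` has the same sign. -/
def Conformal (Θ : Finset ℝ) (p q : ℝ[X]) : Prop :=
  ∀ x ∈ Θ, (0 < q.eval x → 0 < p.eval x) ∧ (q.eval x < 0 → p.eval x < 0)

/-- A difference of two points of `Θ` times a product of `k` linear factors with roots in `Θ`. -/
def IsElementary (Θ : Finset ℝ) (k : ℕ) (q : ℝ[X]) : Prop :=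
  ∃ a ∈ Θ, ∃ b ∈ Θ, ∃ t : ℕ → ℝ, (∀ i, t i ∈ Θ) ∧
    q = C (a - b) * ∏ i ∈ Finset.range k, (X - C (t i))

/-- The zeros of `p` in `Θ`. -/
noncomputable def zerosIn (Θ : Finset ℝ) (p : ℝ[X]) : Finset ℝ := {x ∈ Θ | p.eval x = 0}

variable {Θ : Finset ℝ} {k : ℕ} {p q r : ℝ[X]}

lemma mem_zerosIn {x : ℝ} : x ∈ zerosIn Θ p ↔ x ∈ Θ ∧ p.eval x = 0 := by
  simp [zerosIn]

lemma Conformal.trans (h₁ : Conformal Θ p q) (h₂ : Conformal Θ q r) : Conformal Θ p r :=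
  fun x hx => ⟨fun h => (h₁ x hx).1 ((h₂ x hx).1 h), fun h => (h₁ x hx).2 ((h₂ x hx).2 h)⟩

lemma Conformal.eval_eq_zero (h : Conformal Θ p q) {x : ℝ} (hx : x ∈ Θ) (hp : p.eval x = 0) :
    q.eval x = 0 := by
  by_contra hq
  rcases lt_or_gt_of_ne hq with h' | h'
  · exact absurd ((h x hx).2 h') (by simp [hp])
  · exact absurd ((h x hx).1 h') (by simp [hp])

/-- Moving from `p` in a direction that vanishes on the zeros of `p`, one reaches a conformal
polynomial with more zeros. -/
lemma exists_conformal_sub {h : ℝ[X]} (hz : ∀ x ∈ zerosIn Θ p, h.eval x = 0)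
    (ha : ∃ a ∈ Θ, 0 < h.eval a * p.eval a) :
    ∃ t : ℝ, 0 < t ∧ Conformal Θ p (p - C t * h) ∧
      (zerosIn Θ p).card < (zerosIn Θ (p - C t * h)).card := by
  obtain ⟨a, haΘ, ha⟩ := ha
  -- The least ratio `p / h` over the points where `h` pulls `p` towards zero is the first time at
  -- which a nonzero value of `p - t * h` vanishes. Up to then no sign is reversed.
  obtain ⟨c, hc, hmin⟩ := Finset.exists_min_image
    {x ∈ Θ | 0 < h.eval x * p.eval x} (fun x => p.eval x / h.eval x) ⟨a, by simp [haΘ, ha]⟩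
  simp only [Finset.mem_filter] at hc hmin
  obtain ⟨hcΘ, hc⟩ := hc
  have hc0 : h.eval c ≠ 0 := by rintro h0; simp [h0] at hc
  have hp0 : p.eval c ≠ 0 := by rintro h0; simp [h0] at hc
  have key : ∀ x : ℝ, h.eval x ≠ 0 →
      p.eval x / h.eval x = h.eval x * p.eval x / (h.eval x) ^ 2 := by
    intro x hx; field_simp
  have ht : 0 < p.eval c / h.eval c := by
    rw [key c hc0]; positivity
  refine ⟨p.eval c / h.eval c, ht, ?_, ?_⟩
  · set t := p.eval c / h.eval c
    intro x hx
    simp only [eval_sub, eval_mul, eval_C]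
    by_cases hpx : p.eval x = 0
    · have := hz x (mem_zerosIn.2 ⟨hx, hpx⟩)
      simp [hpx, this]
    by_cases hh : 0 < h.eval x * p.eval x
    · have hle := hmin x ⟨hx, hh⟩
      rcases lt_or_gt_of_ne hpx with hneg | hpos
      · have hhx : h.eval x < 0 := by
          by_contra hcon; push Not at hcon; nlinarith
        rw [le_div_iff_of_neg hhx] at hle
        exact ⟨fun h' => by linarith, fun _ => hneg⟩
      · have hhx : 0 < h.eval x := by
          by_contra hcon; push Not at hcon; nlinarith
        rw [le_div_iff₀ hhx] at hle
        exact ⟨fun _ => hpos, fun h' => by linarith⟩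
    · push Not at hh
      rcases lt_or_gt_of_ne hpx with hneg | hpos
      · have hhx : 0 ≤ h.eval x := by
          by_contra hcon; push Not at hcon; nlinarith
        exact ⟨fun h' => by nlinarith, fun _ => hneg⟩
      · have hhx : h.eval x ≤ 0 := by
          by_contra hcon; push Not at hcon; nlinarith
        exact ⟨fun _ => hpos, fun h' => by nlinarith⟩
  · apply Finset.card_lt_card
    rw [Finset.ssubset_iff_of_subset]
    · refine ⟨c, mem_zerosIn.2 ⟨hcΘ, ?_⟩, fun h' => hp0 (mem_zerosIn.1 h').2⟩
      simp [hc0]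
    · intro x hx
      have h1 := hz x hx
      rw [mem_zerosIn] at hx ⊢
      simp [hx.1, hx.2, h1]

/-- With fewer than `k` zeros there is room for a direction `h = g * l` of degree at most `k`, where
`g` vanishes on the zeros of `p` and `l` is linear. Moving from `p` along `h` and along `-h` until a
new zero appears gives the two ends of a segment that contains `p` in its interior. -/
lemma exists_split (hp : p.degree ≤ k) (hZ : (zerosIn Θ p).card < k) {a b : ℝ} (hab : a ≠ b)
    (ha : a ∈ Θ) (hb : b ∈ Θ) (hpa : p.eval a ≠ 0) (hpb : p.eval b ≠ 0) :
    ∃ c₁ c₂ : ℝ, ∃ p₁ p₂ : ℝ[X], 0 < c₁ ∧ 0 < c₂ ∧ p = C c₁ * p₁ + C c₂ * p₂ ∧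
      p₁.degree ≤ k ∧ p₂.degree ≤ k ∧ Conformal Θ p p₁ ∧ Conformal Θ p p₂ ∧
      (zerosIn Θ p).card < (zerosIn Θ p₁).card ∧ (zerosIn Θ p).card < (zerosIn Θ p₂).card := by
  set g : ℝ[X] := ∏ z ∈ zerosIn Θ p, (X - C z) with hg
  have hgne : ∀ x, p.eval x ≠ 0 → g.eval x ≠ 0 := by
    intro x hx
    rw [hg, eval_prod, Finset.prod_ne_zero_iff]
    intro z hz
    simp only [eval_sub, eval_X, eval_C, sub_ne_zero]
    rintro rfl
    exact hx (mem_zerosIn.1 hz).2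
  have hgz : ∀ x ∈ zerosIn Θ p, g.eval x = 0 := by
    intro x hx
    rw [hg, eval_prod]
    exact Finset.prod_eq_zero hx (by simp)
  -- Interpolation with `l a = p a * g a` and `l b = -(p b * g b)`. Then `h * p` is positive at `a`
  -- and negative at `b`, so the motion stops in both directions.
  set l : ℝ[X] := C (p.eval a * g.eval a / (a - b)) * (X - C b) +
    C (p.eval b * g.eval b / (a - b)) * (X - C a) with hl
  have hab' : a - b ≠ 0 := sub_ne_zero.2 hab
  have hla : l.eval a = p.eval a * g.eval a := by simp [hl]; field_simp
  have hlb : l.eval b = - (p.eval b * g.eval b) := by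
    simp [hl]
    field_simp
    ring
  have hldeg : l.natDegree ≤ 1 := by rw [hl]; compute_degree
  have hgdeg : g.natDegree = (zerosIn Θ p).card := by
    rw [hg, natDegree_prod_of_monic _ _ (fun z _ => monic_X_sub_C z)]; simp
  have hhdeg : (g * l).degree ≤ k := by
    rw [← natDegree_le_iff_degree_le]
    exact natDegree_mul_le.trans (by omega)
  have hga := hgne a hpa
  have hgb := hgne b hpb
  obtain ⟨t₁, ht₁, hc₁, hz₁⟩ := exists_conformal_sub (Θ := Θ) (p := p) (h := g * l)
    (fun x hx => by simp [hgz x hx])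
    ⟨a, ha, by
      rw [eval_mul, hla]
      have : 0 < (g.eval a * p.eval a) ^ 2 := by positivity
      nlinarith⟩
  obtain ⟨t₂, ht₂, hc₂, hz₂⟩ := exists_conformal_sub (Θ := Θ) (p := p) (h := -(g * l))
    (fun x hx => by simp [hgz x hx])
    ⟨b, hb, by
      rw [eval_neg, eval_mul, hlb]
      have : 0 < (g.eval b * p.eval b) ^ 2 := by positivity
      nlinarith⟩
  have hdeg : ∀ (t : ℝ) (f : ℝ[X]), f.degree ≤ k → (p - C t * f).degree ≤ k := by
    intro t f hf
    refine (degree_sub_le _ _).trans (max_le hp ?_)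
    rw [← smul_eq_C_mul]
    exact (degree_smul_le _ _).trans hf
  have hpos : 0 < t₁ + t₂ := by positivity
  refine ⟨t₂ / (t₁ + t₂), t₁ / (t₁ + t₂), _, _, by positivity, by positivity, ?_,
    hdeg _ _ hhdeg, hdeg _ _ (by rwa [degree_neg]), hc₁, hc₂, hz₁, hz₂⟩
  have e1 : C (t₂ / (t₁ + t₂)) + C (t₁ / (t₁ + t₂)) = (1 : ℝ[X]) := by
    rw [← C_add, ← C_1]; congr 1; field_simp; ring
  have e2 : C (t₂ / (t₁ + t₂)) * C t₁ = C (t₁ / (t₁ + t₂)) * C t₂ := by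
    rw [← C_mul, ← C_mul]; congr 1; field_simp
  linear_combination (-p) * e1 + g * l * e2

/-- Fills all `k` root slots even if `S` is smaller: after the elements of `S`, one of them is
repeated. -/
lemma exists_enum {S : Finset ℝ} (hne : S.Nonempty) (hS : S.card ≤ k) :
    ∃ t : ℕ → ℝ, (∀ i, t i ∈ S) ∧ ∀ x ∈ S, ∃ i < k, t i = x := by
  obtain ⟨z, hz⟩ := hne
  refine ⟨fun i => S.toList.getD i z, fun i => ?_, fun x hx => ?_⟩
  · dsimp only
    by_cases h : i < S.toList.length
    · rw [List.getD_eq_getElem _ _ h]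
      exact Finset.mem_toList.1 (List.getElem_mem h)
    · rw [List.getD_eq_default _ _ (by omega)]
      exact hz
  · obtain ⟨i, hi, rfl⟩ := List.getElem_of_mem (Finset.mem_toList.2 hx)
    refine ⟨i, ?_, ?_⟩
    · rw [Finset.length_toList] at hi; omega
    · exact List.getD_eq_getElem _ _ hi

/-- A polynomial with `k` zeros in `Θ`, or with at most one nonzero, is elementary on `Θ` up to a
positive factor. -/
lemma exists_elementary (hΘ : 1 < Θ.card) (hp : p.degree ≤ k)
    (h : k ≤ (zerosIn Θ p).card ∨ ∀ a ∈ Θ, ∀ b ∈ Θ, p.eval a ≠ 0 → p.eval b ≠ 0 → a = b) :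
    ∃ w : ℝ, 0 < w ∧ ∃ q, IsElementary Θ k q ∧ ∀ x ∈ Θ, p.eval x = w * q.eval x := by
  obtain ⟨u, hu, v, hv, huv⟩ := Finset.one_lt_card.1 hΘ
  wlog huv' : v < u generalizing u v
  · exact this v hv u hu huv.symm (lt_of_le_of_ne (not_lt.1 huv') huv)
  -- The factor `a - b` of an elementary polynomial encodes the sign of `c`: it is `u - v`, `v - u`
  -- or `v - v`. Two distinct points of `Θ` are needed for this.
  suffices H : ∃ c : ℝ, ∃ t : ℕ → ℝ, (∀ i, t i ∈ Θ) ∧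
      ∀ x ∈ Θ, p.eval x = c * (∏ i ∈ Finset.range k, (X - C (t i))).eval x by
    obtain ⟨c, t, ht, hc⟩ := H
    have huv0 : 0 < u - v := sub_pos.2 huv'
    rcases lt_trichotomy c 0 with hc0 | rfl | hc0
    · refine ⟨-c / (u - v), div_pos (by linarith) huv0, _, ⟨v, hv, u, hu, t, ht, rfl⟩, ?_⟩
      intro x hx
      rw [hc x hx, eval_mul, eval_C]
      field_simp
      ring
    · exact ⟨1, one_pos, _, ⟨v, hv, v, hv, t, ht, rfl⟩, fun x hx => by simp [hc x hx]⟩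
    · refine ⟨c / (u - v), div_pos hc0 huv0, _, ⟨u, hu, v, hv, t, ht, rfl⟩, ?_⟩
      intro x hx
      rw [hc x hx, eval_mul, eval_C]
      field_simp
  have hsub : zerosIn Θ p ⊆ Θ := Finset.filter_subset _ _
  by_cases hk : k ≤ (zerosIn Θ p).card
  · obtain ⟨S, hS, hSk⟩ := Finset.exists_subset_card_eq hk
    obtain ⟨t, htΘ, ht⟩ : ∃ t : ℕ → ℝ, (∀ i, t i ∈ Θ) ∧ ∀ x ∈ S, ∃ i < k, t i = x := by
      rcases S.eq_empty_or_nonempty with rfl | hne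
      · exact ⟨fun _ => u, fun _ => hu, by simp⟩
      · obtain ⟨t, h1, h2⟩ := exists_enum hne hSk.le
        exact ⟨t, fun i => hsub (hS (h1 i)), h2⟩
    refine ⟨p.coeff k, t, htΘ, fun x _ => ?_⟩
    set g : ℝ[X] := ∏ i ∈ Finset.range k, (X - C (t i)) with hg
    have hgm : g.Monic := monic_prod_of_monic _ _ (fun z _ => monic_X_sub_C _)
    have hgdeg : g.natDegree = k := by
      rw [hg, natDegree_prod_of_monic _ _ (fun z _ => monic_X_sub_C _)]; simp
    have hgk : g.coeff k = 1 := by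
      have := hgm.coeff_natDegree
      rwa [hgdeg] at this
    -- The coefficients of `X ^ k` cancel, so the difference has degree below `k` but `k` zeros.
    have h0 : p - C (p.coeff k) * g = 0 := by
      apply eq_zero_of_degree_lt_of_eval_finset_eq_zero S
      · rw [hSk, degree_lt_iff_coeff_zero]
        intro m hm
        rcases eq_or_lt_of_le hm with rfl | hm
        · simp [hgk]
        · rw [coeff_sub, coeff_C_mul, coeff_eq_zero_of_natDegree_lt (p := g) (by omega),
            coeff_eq_zero_of_degree_lt (p := p) (hp.trans_lt (by exact_mod_cast hm))]
          simp
      · intro x hx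
        obtain ⟨i, hi, rfl⟩ := ht x hx
        have h1 : g.eval (t i) = 0 := by
          rw [hg, eval_prod]
          exact Finset.prod_eq_zero (Finset.mem_range.2 hi) (by simp)
        simp [h1, (mem_zerosIn.1 (hS hx)).2]
    have := congrArg (eval x) (sub_eq_zero.1 h0)
    simpa using this
  · replace h := h.resolve_left hk
    by_cases hall : ∀ x ∈ Θ, p.eval x = 0
    · exact ⟨0, fun _ => u, fun _ => hu, fun x hx => by simp [hall x hx]⟩
    push Not at hall
    obtain ⟨a, ha, hpa⟩ := hall
    have hzero : ∀ x ∈ Θ, x ≠ a → x ∈ zerosIn Θ p := by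
      intro x hx hxa
      refine mem_zerosIn.2 ⟨hx, ?_⟩
      by_contra hpx
      exact hxa (h x hx a ha hpx hpa)
    have hne : (zerosIn Θ p).Nonempty := by
      by_cases hua : u = a
      · exact ⟨v, hzero v hv (by rintro rfl; exact huv hua)⟩
      · exact ⟨u, hzero u hu hua⟩
    obtain ⟨t, ht1, ht2⟩ := exists_enum hne (not_le.1 hk).le
    have hga : (∏ i ∈ Finset.range k, (X - C (t i))).eval a ≠ 0 := by
      rw [eval_prod, Finset.prod_ne_zero_iff]
      intro i _
      simp only [eval_sub, eval_X, eval_C, sub_ne_zero]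
      intro hai
      exact hpa (hai ▸ (mem_zerosIn.1 (ht1 i)).2)
    refine ⟨p.eval a / (∏ i ∈ Finset.range k, (X - C (t i))).eval a, t,
      fun i => hsub (ht1 i), fun x hx => ?_⟩
    by_cases hxa : x = a
    · subst hxa
      field_simp
    · have hxz := hzero x hx hxa
      obtain ⟨i, hi, rfl⟩ := ht2 x hxz
      have hgi : (∏ i ∈ Finset.range k, (X - C (t i))).eval (t i) = 0 := by
        rw [eval_prod]
        exact Finset.prod_eq_zero (Finset.mem_range.2 hi) (by simp)
      rw [(mem_zerosIn.1 hxz).2, hgi, mul_zero]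

lemma Conformal.of_eq_mul {w : ℝ} (hw : 0 < w) (h : ∀ x ∈ Θ, p.eval x = w * q.eval x) :
    Conformal Θ p q := by
  intro x hx
  rw [h x hx]
  exact ⟨fun h => mul_pos hw h, fun h => mul_neg_of_pos_of_neg hw h⟩

/-- Every polynomial of degree at most `k` is on `Θ` a positive combination of `2 ^ m` elementary
polynomials that are conformal to it, as soon as it has at least `k - m` zeros. -/
lemma exists_conformal_decomposition (hΘ : 1 < Θ.card) (m : ℕ) (p : ℝ[X]) (hp : p.degree ≤ k)
    (hm : k ≤ (zerosIn Θ p).card + m) :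
    ∃ (w : ℕ → ℝ) (q : ℕ → ℝ[X]), (∀ i, 0 < w i) ∧ (∀ i, IsElementary Θ k (q i)) ∧
      (∀ i, Conformal Θ p (q i)) ∧
      ∀ x ∈ Θ, p.eval x = ∑ i ∈ Finset.range (2 ^ m), w i * (q i).eval x := by
  induction m generalizing p with
  | zero =>
    obtain ⟨w, hw, q, hq, h⟩ := exists_elementary hΘ hp (Or.inl hm)
    exact ⟨fun _ => w, fun _ => q, fun _ => hw, fun _ => hq,
      fun _ => Conformal.of_eq_mul hw h, by simpa using h⟩
  | succ m ih =>
    have key : ∀ (c₁ c₂ : ℝ) (p₁ p₂ : ℝ[X]), 0 < c₁ → 0 < c₂ → p = C c₁ * p₁ + C c₂ * p₂ →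
        p₁.degree ≤ k → p₂.degree ≤ k → Conformal Θ p p₁ → Conformal Θ p p₂ →
        k ≤ (zerosIn Θ p₁).card + m → k ≤ (zerosIn Θ p₂).card + m →
        ∃ (w : ℕ → ℝ) (q : ℕ → ℝ[X]), (∀ i, 0 < w i) ∧ (∀ i, IsElementary Θ k (q i)) ∧
          (∀ i, Conformal Θ p (q i)) ∧
          ∀ x ∈ Θ, p.eval x = ∑ i ∈ Finset.range (2 ^ (m + 1)), w i * (q i).eval x := by
      intro c₁ c₂ p₁ p₂ hc₁ hc₂ hpe hd₁ hd₂ hf₁ hf₂ hz₁ hz₂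
      obtain ⟨w₁, q₁, hw₁, hq₁, hg₁, hs₁⟩ := ih p₁ hd₁ hz₁
      obtain ⟨w₂, q₂, hw₂, hq₂, hg₂, hs₂⟩ := ih p₂ hd₂ hz₂
      refine ⟨fun i => if i < 2 ^ m then c₁ * w₁ i else c₂ * w₂ (i - 2 ^ m),
        fun i => if i < 2 ^ m then q₁ i else q₂ (i - 2 ^ m), ?_, ?_, ?_, ?_⟩
      · intro i
        dsimp only
        split_ifs
        · exact mul_pos hc₁ (hw₁ i)
        · exact mul_pos hc₂ (hw₂ _)
      · intro i
        dsimp only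
        split_ifs
        · exact hq₁ i
        · exact hq₂ _
      · intro i
        dsimp only
        split_ifs
        · exact hf₁.trans (hg₁ i)
        · exact hf₂.trans (hg₂ _)
      · intro x hx
        have hsplit : (2 : ℕ) ^ (m + 1) = 2 ^ m + 2 ^ m := by ring
        rw [hsplit, Finset.sum_range_add]
        conv_lhs => rw [hpe]
        simp only [eval_add, eval_mul, eval_C, hs₁ x hx, hs₂ x hx, Finset.mul_sum]
        congr 1
        · refine Finset.sum_congr rfl fun i hi => ?_
          simp [Finset.mem_range.1 hi, mul_assoc]
        · refine Finset.sum_congr rfl fun i _ => ?_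
          simp [mul_assoc]
    by_cases hlt : k ≤ (zerosIn Θ p).card + m
    -- No split is needed here; `p` is halved only to keep the number of summands equal to `2 ^ (m +
    -- 1)`.
    · refine key (1 / 2) (1 / 2) p p (by norm_num) (by norm_num) ?_ hp hp
        (fun _ _ => ⟨id, id⟩) (fun _ _ => ⟨id, id⟩) hlt hlt
      rw [← add_mul, ← C_add]
      norm_num
    by_cases hone : ∀ a ∈ Θ, ∀ b ∈ Θ, p.eval a ≠ 0 → p.eval b ≠ 0 → a = b
    · obtain ⟨w, hw, q, hq, h⟩ := exists_elementary hΘ hp (Or.inr hone)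
      refine ⟨fun _ => w / 2 ^ (m + 1), fun _ => q, fun _ => by positivity, fun _ => hq,
        fun _ => Conformal.of_eq_mul hw h, fun x hx => ?_⟩
      rw [h x hx]
      simp only [Finset.sum_const, Finset.card_range, nsmul_eq_mul]
      push_cast
      field_simp
    · push Not at hone
      obtain ⟨a, ha, b, hb, hpa, hpb, hab⟩ := hone
      obtain ⟨c₁, c₂, p₁, p₂, hc₁, hc₂, hpe, hd₁, hd₂, hf₁, hf₂, hz₁, hz₂⟩ :=
        exists_split hp (by omega) hab ha hb hpa hpb
      exact key c₁ c₂ p₁ p₂ hc₁ hc₂ hpe hd₁ hd₂ hf₁ hf₂ (by omega) (by omega)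

/-- Changing the positive weights of a conformal decomposition does not change any sign. -/
lemma sign_of_conformal {N : ℕ} {w w' : ℕ → ℝ} {q : ℕ → ℝ[X]} (hw' : ∀ i, 0 < w' i)
    (hq : ∀ i, Conformal Θ p (q i)) {x y : ℝ} (hx : x ∈ Θ)
    (hp : p.eval x = ∑ i ∈ Finset.range N, w i * (q i).eval x)
    (hy : y = ∑ i ∈ Finset.range N, w' i * (q i).eval x) :
    (0 < y ↔ 0 < p.eval x) ∧ (y < 0 ↔ p.eval x < 0) := by
  have hpos : 0 < p.eval x → 0 < y := by
    intro h
    have hnn : ∀ i, 0 ≤ (q i).eval x := fun i =>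
      not_lt.1 fun hlt => absurd ((hq i x hx).2 hlt) (not_lt.2 h.le)
    obtain ⟨i, hi, hne⟩ := Finset.exists_ne_zero_of_sum_ne_zero (hp ▸ h.ne')
    have hqi : 0 < (q i).eval x := lt_of_le_of_ne (hnn i) fun h0 => hne (by simp [← h0])
    rw [hy]
    exact Finset.sum_pos' (fun j _ => mul_nonneg (hw' j).le (hnn j)) ⟨i, hi, mul_pos (hw' i) hqi⟩
  have hneg : p.eval x < 0 → y < 0 := by
    intro h
    have hnn : ∀ i, (q i).eval x ≤ 0 := fun i =>
      not_lt.1 fun hlt => absurd ((hq i x hx).1 hlt) (not_lt.2 h.le)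
    obtain ⟨i, hi, hne⟩ := Finset.exists_ne_zero_of_sum_ne_zero (hp ▸ h.ne)
    have hqi : (q i).eval x < 0 := lt_of_le_of_ne (hnn i) fun h0 => hne (by simp [h0])
    rw [hy]
    exact Finset.sum_neg' (fun j _ => mul_nonpos_of_nonneg_of_nonpos (hw' j).le (hnn j))
      ⟨i, hi, mul_neg_of_pos_of_neg (hw' i) hqi⟩
  have hzero : p.eval x = 0 → y = 0 := by
    intro h
    rw [hy]
    exact Finset.sum_eq_zero fun i _ => by rw [(hq i).eval_eq_zero hx h, mul_zero]
  rcases lt_trichotomy (p.eval x) 0 with h | h | h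
  · have := hneg h
    exact ⟨⟨fun h' => by linarith, fun h' => by linarith⟩, fun _ => h, fun _ => this⟩
  · simp [h, hzero h]
  · have := hpos h
    exact ⟨⟨fun _ => h, fun _ => this⟩, fun h' => by linarith, fun h' => by linarith⟩

end Conformal

/-! ### Finitely many trace-zero candidates, encoded by indices -/

section Candidates

/-- The sum of the values of `p` at `mem 0, …, mem (D - 1)`, weighted by
`mem D, …, mem (2 * D - 1)`. -/
noncomputable def trace (D : ℕ) (mem : ℕ → ℝ) (p : ℝ[X]) : ℝ :=
  ∑ j ∈ Finset.range D, mem (D + j) * p.eval (mem j)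

/-- The elementary polynomial described by the `k + 2` indices `v b, v (b + 1), …`. -/
noncomputable def term (k : ℕ) (mem : ℕ → ℝ) (b : ℕ) (v : ℕ → ℕ) : ℝ[X] :=
  C (mem (v b) - mem (v (b + 1))) * ∏ l ∈ Finset.range k, (X - C (mem (v (b + 2 + l))))

/-- The sequence `v` is cut into blocks of `k + 2` indices, one per term, and `a` is the first block
used. -/
noncomputable def termSum (k : ℕ) (mem : ℕ → ℝ) (a N : ℕ) (v : ℕ → ℕ) : ℝ[X] :=
  ∑ i ∈ Finset.range N, term k mem ((a + i) * (k + 2)) v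

/-- The combination of `u` and `w` in which the traces cancel. -/
noncomputable def balance (D : ℕ) (mem : ℕ → ℝ) (u w : ℝ[X]) : ℝ[X] :=
  C (trace D mem u) * w - C (trace D mem w) * u

open Classical in
/-- The trace-zero polynomial described by `2 * N * (k + 2)` indices. -/
noncomputable def candidate (k N D : ℕ) (mem : ℕ → ℝ) (v : ℕ → ℕ) : ℝ[X] :=
  if trace D mem (termSum k mem 0 N v) = 0 then termSum k mem 0 N v
  else balance D mem (termSum k mem 0 N v) (termSum k mem N N v)

variable {k N D : ℕ} {mem : ℕ → ℝ}

lemma trace_balance (u w : ℝ[X]) : trace D mem (balance D mem u w) = 0 := by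
  have : ∀ c d : ℝ, trace D mem (C c * w - C d * u) = c * trace D mem w - d * trace D mem u := by
    intro c d
    simp only [trace, Finset.mul_sum, ← Finset.sum_sub_distrib, eval_sub, eval_mul, eval_C]
    exact Finset.sum_congr rfl fun _ _ => by ring
  rw [balance, this]
  ring

lemma trace_sum (n : ℕ) (f : ℕ → ℝ[X]) :
    trace D mem (∑ i ∈ Finset.range n, f i) = ∑ i ∈ Finset.range n, trace D mem (f i) := by
  simp only [trace, eval_finsetSum, Finset.mul_sum]
  exact Finset.sum_comm

lemma natDegree_term_le (b : ℕ) (v : ℕ → ℕ) : (term k mem b v).natDegree ≤ k := by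
  refine natDegree_C_mul_le _ _ |>.trans ?_
  rw [natDegree_prod_of_monic _ _ (fun _ _ => monic_X_sub_C _)]
  simp

lemma natDegree_termSum_le (a N : ℕ) (v : ℕ → ℕ) : (termSum k mem a N v).natDegree ≤ k :=
  natDegree_sum_le_of_forall_le _ _ fun _ _ => natDegree_term_le _ _

lemma natDegree_balance_le {u w : ℝ[X]} (hu : u.natDegree ≤ k) (hw : w.natDegree ≤ k) :
    (balance D mem u w).natDegree ≤ k :=
  (natDegree_sub_le _ _).trans
    (max_le ((natDegree_C_mul_le _ _).trans hw) ((natDegree_C_mul_le _ _).trans hu))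

lemma termSum_congr {a : ℕ} {v v' : ℕ → ℕ} (h : ∀ i < (a + N) * (k + 2), v i = v' i) :
    termSum k mem a N v = termSum k mem a N v' := by
  refine Finset.sum_congr rfl fun i hi => ?_
  have hl : ∀ l < k + 2, v ((a + i) * (k + 2) + l) = v' ((a + i) * (k + 2) + l) := fun l hl => by
    refine h _ ?_
    calc (a + i) * (k + 2) + l < (a + i + 1) * (k + 2) := by rw [add_mul _ 1]; omega
      _ ≤ (a + N) * (k + 2) := Nat.mul_le_mul_right _ (by have := Finset.mem_range.1 hi; omega)
  have h0 := hl 0 (by omega)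
  rw [add_zero] at h0
  rw [term, term, h0, hl 1 (by omega)]
  congr 1
  refine Finset.prod_congr rfl fun l hl' => ?_
  rw [add_assoc, hl (2 + l) (by have := Finset.mem_range.1 hl'; omega)]

/-- Makes the search finite: the indices beyond the enumerated ones may be replaced by whatever the
registers contain. -/
lemma candidate_congr {v v' : ℕ → ℕ} (h : ∀ i < 2 * N * (k + 2), v i = v' i) :
    candidate k N D mem v = candidate k N D mem v' := by
  have h0 : termSum k mem 0 N v = termSum k mem 0 N v' := termSum_congr fun i hi =>
    h i (hi.trans_le (Nat.mul_le_mul_right _ (by omega)))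
  have h1 : termSum k mem N N v = termSum k mem N N v' := termSum_congr fun i hi =>
    h i (hi.trans_le (Nat.mul_le_mul_right _ (by omega)))
  rw [candidate, candidate, h0, h1]

lemma term_block (f : ℕ → ℕ → ℕ) (i : ℕ) :
    term k mem (i * (k + 2)) (fun x => f (x / (k + 2)) (x % (k + 2))) = term k mem 0 (f i) := by
  have h : ∀ l < k + 2, (i * (k + 2) + l) / (k + 2) = i ∧ (i * (k + 2) + l) % (k + 2) = l := by
    intro l hl
    rw [mul_comm, Nat.mul_add_div (by omega), Nat.mul_add_mod, Nat.div_eq_of_lt hl,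
      Nat.mod_eq_of_lt hl]
    simp
  have h0 := h 0 (by omega)
  have h1 := h 1 (by omega)
  rw [add_zero] at h0
  simp only [term, h0.1, h0.2, h1.1, h1.2, zero_add]
  congr 1
  refine Finset.prod_congr rfl fun l hl => ?_
  have h2 := h (2 + l) (by have := Finset.mem_range.1 hl; omega)
  rw [← add_assoc] at h2
  rw [h2.1, h2.2]

lemma IsElementary.exists_eq_term {Θ : Finset ℝ} (hΘ : Θ = (Finset.range D).image mem) {q : ℝ[X]}
    (hq : IsElementary Θ k q) : ∃ e : ℕ → ℕ, (∀ i, e i < D) ∧ q = term k mem 0 e := by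
  have H : ∀ x ∈ Θ, ∃ j < D, mem j = x := by
    intro x hx
    simpa [hΘ] using hx
  obtain ⟨a, ha, b, hb, t, ht, rfl⟩ := hq
  obtain ⟨ja, hja, rfl⟩ := H a ha
  obtain ⟨jb, hjb, rfl⟩ := H b hb
  choose j hj hjt using fun i => H (t i) (ht i)
  refine ⟨fun i => if i = 0 then ja else if i = 1 then jb else j (i - 2), fun i => ?_, ?_⟩
  · dsimp only
    split_ifs
    · exact hja
    · exact hjb
    · exact hj _
  · simp only [term, zero_add, if_true]
    congr 1
    refine Finset.prod_congr rfl fun l _ => ?_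
    rw [if_neg (by omega), if_neg (by omega), Nat.add_sub_cancel_left, hjt]

/-- If a positive combination of the `t i` vanishes, then either all of them are zero or both their
positive and their negative part are nonzero. -/
lemma parts_of_sum_eq_zero {w t : ℕ → ℝ} (hw : ∀ i, 0 < w i)
    (hsum : ∑ i ∈ Finset.range N, w i * t i = 0) :
    ((∑ i ∈ Finset.range N, if 0 ≤ t i then t i else 0) = 0 → ∀ i ∈ Finset.range N, t i = 0) ∧
    ((∑ i ∈ Finset.range N, if 0 ≤ t i then t i else 0) ≠ 0 →
      0 < (∑ i ∈ Finset.range N, if 0 ≤ t i then t i else 0) ∧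
      (∑ i ∈ Finset.range N, if 0 ≤ t i then 0 else t i) < 0) := by
  have hpos : ∀ i ∈ Finset.range N, 0 ≤ if 0 ≤ t i then t i else 0 := fun i _ => by
    split_ifs with h
    exacts [h, le_rfl]
  have hneg : ∀ i ∈ Finset.range N, (if 0 ≤ t i then 0 else t i) ≤ 0 := fun i _ => by
    split_ifs with h
    exacts [le_rfl, (not_le.1 h).le]
  have hzero : ∀ i ∈ Finset.range N, w i * t i = 0 → t i = 0 := fun i _ h =>
    (mul_eq_zero.1 h).resolve_left (hw i).ne'
  refine ⟨fun h0 i hi => ?_, fun h0 => ⟨(Finset.sum_nonneg hpos).lt_of_ne h0.symm,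
    (Finset.sum_nonpos hneg).lt_of_ne fun h => h0 (Finset.sum_eq_zero fun i hi => ?_)⟩⟩
  · rw [Finset.sum_eq_zero_iff_of_nonneg hpos] at h0
    have hle : ∀ i ∈ Finset.range N, t i ≤ 0 := fun i hi => by
      by_contra hcon
      have := h0 i hi
      rw [if_pos (not_le.1 hcon).le] at this
      exact hcon this.le
    exact hzero i hi ((Finset.sum_eq_zero_iff_of_nonpos fun i hi =>
      mul_nonpos_of_nonneg_of_nonpos (hw i).le (hle i hi)).1 hsum i hi)
  · rw [Finset.sum_eq_zero_iff_of_nonpos hneg] at h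
    have hge : ∀ i ∈ Finset.range N, 0 ≤ t i := fun i hi => by
      by_contra hcon
      have := h i hi
      rw [if_neg hcon] at this
      exact hcon this.ge
    rw [hzero i hi ((Finset.sum_eq_zero_iff_of_nonneg fun i hi =>
      mul_nonneg (hw i).le (hge i hi)).1 hsum i hi), ite_self]

/-- Every trace-zero polynomial of degree at most `k` has the same signs as some candidate. -/
lemma exists_candidate {Θ : Finset ℝ} (hΘ : Θ = (Finset.range D).image mem) (hcard : 1 < Θ.card)
    {p : ℝ[X]} (hp : p.degree ≤ k) (htr : trace D mem p = 0) :
    ∃ v : ℕ → ℕ, (∀ i, v i < D) ∧ ∀ x ∈ Θ,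
      (0 < (candidate k (2 ^ k) D mem v).eval x ↔ 0 < p.eval x) ∧
      ((candidate k (2 ^ k) D mem v).eval x < 0 ↔ p.eval x < 0) := by
  obtain ⟨w, q, hw, hq, hc, hs⟩ := exists_conformal_decomposition hcard k p hp (by omega)
  set N := 2 ^ k with hN
  choose e heD he using fun i => (hq i).exists_eq_term hΘ
  have hD : 0 < D := (Nat.zero_le _).trans_lt (heD 0 0)
  -- Block `i` describes `q i` if its trace is nonnegative, and block `N + i` describes it
  -- otherwise. The unused one of the two is filled with the index `0`, which encodes the zero
  -- polynomial because `mem 0 - mem 0 = 0`.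
  set f : ℕ → ℕ → ℕ := fun i l =>
    if i < N then (if 0 ≤ trace D mem (q i) then e i l else 0)
    else if 0 ≤ trace D mem (q (i - N)) then 0 else e (i - N) l with hf
  have hterm0 : term k mem 0 (fun _ => 0) = 0 := by simp [term]
  refine ⟨fun x => f (x / (k + 2)) (x % (k + 2)), fun x => ?_, ?_⟩
  · simp only [hf]
    split_ifs <;> first | exact heD _ _ | exact hD
  set v : ℕ → ℕ := fun x => f (x / (k + 2)) (x % (k + 2)) with hv
  have hU : termSum k mem 0 N v =
      ∑ i ∈ Finset.range N, if 0 ≤ trace D mem (q i) then q i else 0 := by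
    refine Finset.sum_congr rfl fun i hi => ?_
    rw [zero_add, hv, term_block]
    split_ifs with h
    · conv_rhs => rw [he i]
      congr 1
      ext l
      simp [hf, Finset.mem_range.1 hi, h]
    · rw [← hterm0]
      congr 1
      ext l
      simp only [hf, Finset.mem_range.1 hi, h, if_true, if_false]
  have hW : termSum k mem N N v =
      ∑ i ∈ Finset.range N, if 0 ≤ trace D mem (q i) then 0 else q i := by
    refine Finset.sum_congr rfl fun i hi => ?_
    rw [hv, term_block]
    split_ifs with h
    · rw [← hterm0]
      congr 1
      ext l
      simp [hf, h]
    · conv_rhs => rw [he i]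
      congr 1
      ext l
      simp only [hf, add_tsub_cancel_left, h, if_false, not_lt.2 (Nat.le_add_right N i)]
  have htrU : trace D mem (termSum k mem 0 N v) =
      ∑ i ∈ Finset.range N, if 0 ≤ trace D mem (q i) then trace D mem (q i) else 0 := by
    rw [hU, trace_sum]
    refine Finset.sum_congr rfl fun i _ => ?_
    split_ifs <;> simp [trace]
  have htrW : trace D mem (termSum k mem N N v) =
      ∑ i ∈ Finset.range N, if 0 ≤ trace D mem (q i) then 0 else trace D mem (q i) := by
    rw [hW, trace_sum]
    refine Finset.sum_congr rfl fun i _ => ?_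
    split_ifs <;> simp [trace]
  have hsum : ∑ i ∈ Finset.range N, w i * trace D mem (q i) = 0 := by
    rw [← htr]
    simp only [trace, Finset.mul_sum]
    rw [Finset.sum_comm]
    refine Finset.sum_congr rfl fun j hj => ?_
    rw [hs (mem j) (by rw [hΘ]; exact Finset.mem_image_of_mem _ hj), Finset.mul_sum]
    exact Finset.sum_congr rfl fun i _ => by ring
  obtain ⟨hU0, hUW⟩ := parts_of_sum_eq_zero hw hsum
  rw [← htrU] at hU0 hUW
  rw [← htrW] at hUW
  intro x hx
  by_cases h0 : trace D mem (termSum k mem 0 N v) = 0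
  · refine sign_of_conformal (w := w) (w' := fun _ => 1) (fun _ => one_pos) hc hx (hs x hx) ?_
    rw [candidate, if_pos h0, hU, eval_finsetSum]
    refine Finset.sum_congr rfl fun i hi => ?_
    rw [if_pos (hU0 h0 i hi).ge, one_mul]
  · obtain ⟨hUpos, hWneg⟩ := hUW h0
    -- The weights that `balance` gives to the pieces in `U` and in `W`; both are positive since `tr
    -- W < 0 < tr U`.
    refine sign_of_conformal (w := w) (w' := fun i => if 0 ≤ trace D mem (q i) then
      -trace D mem (termSum k mem N N v) else trace D mem (termSum k mem 0 N v)) (fun i => ?_)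
      hc hx (hs x hx) ?_
    · split_ifs
      · linarith
      · exact hUpos
    · rw [candidate, if_neg h0, balance]
      generalize trace D mem (termSum k mem 0 N v) = α
      generalize trace D mem (termSum k mem N N v) = β
      rw [hU, hW]
      simp only [eval_sub, eval_mul, eval_C, eval_finsetSum, Finset.mul_sum,
        ← Finset.sum_sub_distrib]
      refine Finset.sum_congr rfl fun i _ => ?_
      split_ifs <;> simp

end Candidates

/-! ### Program logic with time bounds -/

section Programs

/-- `c`, started in `s`, halts after at most `B` steps in a state that satisfies `Q`. -/
def Runs (c : Prog) (s : State) (B : ℕ) (Q : State → Prop) : Prop :=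
  ∃ t s', Exec c s t s' ∧ t ≤ B ∧ Q s'

variable {c c₁ c₂ : Prog} {s : State} {B B₁ B₂ : ℕ} {Q Q' : State → Prop}

lemma Runs.mono (h : Runs c s B₁ Q') (hB : B₁ ≤ B₂) (hQ : ∀ s', Q' s' → Q s') :
    Runs c s B₂ Q := by
  obtain ⟨t, s', he, ht, hq⟩ := h
  exact ⟨t, s', he, ht.trans hB, hQ _ hq⟩

lemma Runs.skip (h : Q s) : Runs .skip s 1 Q := ⟨_, _, .skip s, le_rfl, h⟩

lemma Runs.setReg {x : ℕ} {e : RExp}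
    (h : Q { s with reg := Function.update s.reg x (e.eval s) }) :
    Runs (.setReg x e) s (e.cost + 1) Q := ⟨_, _, .setReg x e s, le_rfl, h⟩

lemma Runs.setIdx {x : ℕ} {e : IExp}
    (h : Q { s with idx := Function.update s.idx x (e.eval s) }) :
    Runs (.setIdx x e) s (e.cost + 1) Q := ⟨_, _, .setIdx x e s, le_rfl, h⟩

lemma Runs.seq (h₁ : Runs c₁ s B₁ Q') (h₂ : ∀ s', Q' s' → Runs c₂ s' B₂ Q) :
    Runs (.seq c₁ c₂) s (B₁ + B₂) Q := by
  obtain ⟨t₁, s₁, he₁, ht₁, hq₁⟩ := h₁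
  obtain ⟨t₂, s₂, he₂, ht₂, hq₂⟩ := h₂ s₁ hq₁
  exact ⟨_, _, he₁.seq he₂, by omega, hq₂⟩

lemma Runs.ite {b : Test} (h₁ : b.Holds s → Runs c₁ s B₁ Q) (h₂ : ¬ b.Holds s → Runs c₂ s B₂ Q) :
    Runs (.ite b c₁ c₂) s (b.cost + B₁ + B₂ + 1) Q := by
  by_cases hb : b.Holds s
  · obtain ⟨t, s', he, ht, hq⟩ := h₁ hb
    exact ⟨_, _, .iteTrue hb he, by omega, hq⟩
  · obtain ⟨t, s', he, ht, hq⟩ := h₂ hb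
    exact ⟨_, _, .iteFalse hb he, by omega, hq⟩

/-- Runs `c` with index register `x` going through `0, …, D - 1`, where `D` is the content of index
register `0`. -/
def Prog.loop (x : ℕ) (c : Prog) : Prog :=
  .seq (.setIdx x (.const 0))
    (.while (.idxLt (.var x) (.var 0)) (.seq c (.setIdx x (.add (.var x) (.const 1)))))

/-- A round costs `B + 8`: 3 for the test, 1 for the `while`, 4 for the increment. The failing test
costs 4 and the initialization 2. -/
lemma Runs.loop {x D : ℕ} (J : ℕ → State → Prop)
    (hJ : ∀ i s, J i s → s.idx x = i ∧ s.idx 0 = D)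
    (hstep : ∀ i < D, ∀ s, J i s → Runs c s B fun s' =>
      J (i + 1) { s' with idx := Function.update s'.idx x (s'.idx x + 1) })
    (h0 : J 0 { s with idx := Function.update s.idx x 0 }) :
    Runs (.loop x c) s (D * (B + 8) + 6) (J D) := by
  have key : ∀ n i s, i + n = D → J i s →
      Runs (.while (.idxLt (.var x) (.var 0)) (.seq c (.setIdx x (.add (.var x) (.const 1))))) s
        (n * (B + 8) + 4) (J D) := by
    intro n
    induction n with
    | zero =>
      intro i s hi hs
      obtain ⟨h1, h2⟩ := hJ i s hs
      refine ⟨_, _, .whileFalse ?_, ?_, ?_⟩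
      · simp [Test.Holds, IExp.eval, h1, h2]; omega
      · simp [Test.cost, IExp.cost]
      · rwa [← hi]
    | succ n ih =>
      intro i s hi hs
      obtain ⟨h1, h2⟩ := hJ i s hs
      obtain ⟨t, s₁, he, ht, hq⟩ := hstep i (by omega) s hs
      obtain ⟨t', s₂, he', ht', hq'⟩ := ih (i + 1) _ (by omega) hq
      refine ⟨_, _, .whileTrue ?_ (.seq he (.setIdx x _ _)) he', ?_, hq'⟩
      · simp [Test.Holds, IExp.eval, h1, h2]; omega
      · simp only [Test.cost, IExp.cost]
        have : (n + 1) * (B + 8) = n * (B + 8) + (B + 8) := by ring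
        omega
  have := Runs.seq (Runs.setIdx (e := .const 0) (Q := J 0) (s := s) h0)
    (fun s' hs' => key D 0 s' (by omega) hs')
  refine this.mono ?_ fun _ h => h
  simp only [IExp.cost]
  omega

/-- Sets the registers `r, …, r + n - 1` to the values of `e 0, …, e (n - 1)`. -/
def Prog.assign (r : ℕ) (e : ℕ → RExp) : ℕ → Prog
  | 0 => .skip
  | n + 1 => .seq (Prog.assign r e n) (.setReg (r + n) (e n))

def assignTime (e : ℕ → RExp) : ℕ → ℕ
  | 0 => 1
  | n + 1 => assignTime e n + ((e n).cost + 1)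

/-- When `e i` is evaluated, the registers `r, …, r + i - 1` have already been overwritten, so its
value must not depend on them. It may depend on register `r + i` itself, which allows accumulation.
-/
lemma Runs.assign {r : ℕ} {e : ℕ → RExp} {v : ℕ → ℝ} (n : ℕ)
    (he : ∀ i < n, ∀ s' : State, s'.idx = s.idx → s'.mem = s.mem →
      (∀ x, x < r ∨ r + i ≤ x → s'.reg x = s.reg x) → (e i).eval s' = v i) :
    Runs (.assign r e n) s (assignTime e n) fun s' => s'.idx = s.idx ∧ s'.mem = s.mem ∧
      (∀ i < n, s'.reg (r + i) = v i) ∧ ∀ x, x < r ∨ r + n ≤ x → s'.reg x = s.reg x := by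
  induction n with
  | zero => exact Runs.skip ⟨rfl, rfl, by simp, fun _ _ => rfl⟩
  | succ n ih =>
    refine Runs.seq (ih fun i hi => he i (by omega)) ?_
    rintro s' ⟨h1, h2, h3, h4⟩
    refine Runs.setReg ⟨h1, h2, ?_, ?_⟩
    · intro i hi
      rcases Nat.lt_succ_iff_lt_or_eq.1 hi with hi | rfl
      · simp only
        rw [Function.update_of_ne (by omega), h3 i hi]
      · simp only [Function.update_self]
        exact he i (by omega) s' h1 h2 h4
    · intro x hx
      simp only
      rw [Function.update_of_ne (by omega), h4 x (by omega)]

/-- `m` nested loops over the index registers `3, …, m + 2`. -/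
def Prog.nest (c : Prog) : ℕ → Prog
  | 0 => c
  | m + 1 => .loop (3 + m) (Prog.nest c m)

/-- `Done v b` says that the value `b` accounts for the index vector `v`. Real register `0` never
decreases and `Done` is monotone in `b`, so what one round achieves is kept by all later rounds. -/
lemma Runs.nest {D : ℕ} (T : ℕ[X]) (hT : B = T.eval D) (I : State → Prop)
    (Done : (ℕ → ℕ) → ℝ → Prop)
    (hD : ∀ v b b', Done v b → b ≤ b' → Done v b')
    (hI : ∀ s x i, 3 ≤ x → I s → I { s with idx := Function.update s.idx x i })
    (hI0 : ∀ s, I s → s.idx 0 = D)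
    (hbody : ∀ s, I s → Runs c s B fun s' => I s' ∧ (∀ x ≥ 3, s'.idx x = s.idx x) ∧
      s.reg 0 ≤ s'.reg 0 ∧ Done (fun x => s.idx (3 + x)) (s'.reg 0)) (m : ℕ) :
    ∀ s, I s → Runs (.nest c m) s ((fun T : ℕ[X] => X * (T + 8) + 6)^[m] T |>.eval D) fun s' =>
      I s' ∧ (∀ x ≥ 3 + m, s'.idx x = s.idx x) ∧ s.reg 0 ≤ s'.reg 0 ∧
      ∀ v : ℕ → ℕ, (∀ i < m, v i < D) → (∀ i ≥ m, v i = s.idx (3 + i)) → Done v (s'.reg 0) := by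
  induction m with
  | zero =>
    intro s hs
    refine (hbody s hs).mono (by simp [hT]) ?_
    rintro s' ⟨h1, h2, h3, h4⟩
    refine ⟨h1, h2, h3, fun v _ hv => ?_⟩
    rwa [funext fun i => hv i (Nat.zero_le i)]
  | succ m ih =>
    intro s hs
    have := Runs.loop (c := .nest c m) (x := 3 + m) (s := s) (D := D)
      (B := (fun T : ℕ[X] => X * (T + 8) + 6)^[m] T |>.eval D)
      (fun j s' => I s' ∧ s'.idx (3 + m) = j ∧ (∀ x ≥ 3 + (m + 1), s'.idx x = s.idx x) ∧
        s.reg 0 ≤ s'.reg 0 ∧ ∀ v : ℕ → ℕ, (∀ i < m, v i < D) → v m < j →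
          (∀ i ≥ m + 1, v i = s.idx (3 + i)) → Done v (s'.reg 0)) ?_ ?_ ?_
    · refine this.mono ?_ ?_
      · rw [Function.iterate_succ_apply']
        simp [mul_comm]
      · rintro s' ⟨h1, h2, h3, h4, h5⟩
        exact ⟨h1, h3, h4, fun v hv hv' =>
          h5 v (fun i hi => hv i (by omega)) (hv m (by omega)) hv'⟩
    · rintro i s' ⟨h1, h2, -⟩
      exact ⟨h2, hI0 _ h1⟩
    · rintro j hj s₁ ⟨h1, h2, h3, h4, h5⟩
      refine (ih s₁ h1).mono le_rfl ?_
      rintro s₂ ⟨g1, g2, g3, g4⟩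
      have hm : s₂.idx (3 + m) = j := by rw [g2 _ (by omega), h2]
      refine ⟨hI _ _ _ (by omega) g1, by simp [hm], ?_, h4.trans g3, ?_⟩
      · intro x hx
        simp only
        rw [Function.update_of_ne (by omega), g2 x (by omega), h3 x hx]
      · intro v hv hvm hv'
        rcases Nat.lt_succ_iff_lt_or_eq.1 hvm with hlt | heq
        · exact hD _ _ _ (h5 v hv hlt hv') g3
        · refine g4 v hv fun i hi => ?_
          rcases eq_or_lt_of_le hi with rfl | hi
          · rw [heq, h2]
          · rw [hv' i hi, h3 _ (by omega)]
    · refine ⟨hI _ _ _ (by omega) hs, by simp, ?_, le_rfl,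
        fun v _ h => absurd h (Nat.not_lt_zero _)⟩
      intro x hx
      simp only
      rw [Function.update_of_ne (by omega)]

end Programs

/-! ### Loop-free expressions for coefficients and traces -/

section Expressions

def RExp.pow (e : RExp) : ℕ → RExp
  | 0 => .const 1
  | n + 1 => .mul (e.pow n) e

def RExp.sum (f : ℕ → RExp) : ℕ → RExp
  | 0 => .const 0
  | n + 1 => .add (RExp.sum f n) (f n)

lemma RExp.eval_pow (e : RExp) (s : State) (n : ℕ) : (e.pow n).eval s = e.eval s ^ n := by
  induction n with
  | zero => simp [RExp.pow, RExp.eval]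
  | succ n ih => rw [RExp.pow, RExp.eval, ih, pow_succ]

lemma RExp.eval_sum (f : ℕ → RExp) (s : State) (n : ℕ) :
    (RExp.sum f n).eval s = ∑ i ∈ Finset.range n, (f i).eval s := by
  induction n with
  | zero => simp [RExp.sum, RExp.eval]
  | succ n ih => rw [RExp.sum, RExp.eval, ih, Finset.sum_range_succ]

/-- The coefficients of the product of the `X - θ`, where `θ` runs through the memory cells that the
index registers `b, …, b + l - 1` point at. -/
def factorsE (b : ℕ) : ℕ → ℕ → RExp
  | 0, i => if i = 0 then .const 1 else .const 0
  | l + 1, i => .sub (if i = 0 then .const 0 else factorsE b l (i - 1))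
      (.mul (.load (.var (b + l))) (factorsE b l i))

lemma eval_factorsE (b l i : ℕ) (s : State) : (factorsE b l i).eval s =
    (∏ j ∈ Finset.range l, (X - C (s.mem (s.idx (b + j))))).coeff i := by
  induction l generalizing i with
  | zero =>
    rw [factorsE, Finset.range_zero, Finset.prod_empty, coeff_one]
    split_ifs <;> simp [RExp.eval]
  | succ l ih =>
    rw [factorsE, Finset.prod_range_succ, mul_sub, coeff_sub, coeff_mul_C, RExp.eval, RExp.eval,
      RExp.eval, IExp.eval, ih, mul_comm (s.mem _)]
    congr 1
    rcases i with _ | i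
    · simp [RExp.eval]
    · simp [ih]

/-- The offset `3` is there because index registers `0`, `1`, `2` hold the number of points, the
inner loop counter and the success flag. -/
def termE (k b i : ℕ) : RExp :=
  .mul (.sub (.load (.var (3 + b))) (.load (.var (3 + (b + 1))))) (factorsE (3 + (b + 2)) k i)

def termSumE (k a N i : ℕ) : RExp := RExp.sum (fun n => termE k ((a + n) * (k + 2)) i) N

/-- The trace of the polynomial with coefficients `c`, computed from the moments of the spectrum in
the real registers `k + 2, …, 2 * k + 2`. -/
def traceE (k : ℕ) (c : ℕ → RExp) : RExp :=
  RExp.sum (fun i => .mul (c i) (.reg (k + 2 + i))) (k + 1)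

def balanceE (k : ℕ) (u w : ℕ → RExp) (i : ℕ) : RExp :=
  .sub (.mul (traceE k u) (w i)) (.mul (traceE k w) (u i))

def evalE (k : ℕ) (c : ℕ → RExp) (e : RExp) : RExp :=
  RExp.sum (fun i => .mul (c i) (e.pow i)) (k + 1)

/-- The spectral data and its moments are in place. -/
def Ready (k D : ℕ) (mem : ℕ → ℝ) (s : State) : Prop :=
  s.idx 0 = D ∧ s.mem = mem ∧
    ∀ i ≤ k, s.reg (k + 2 + i) = ∑ j ∈ Finset.range D, mem (D + j) * mem j ^ i

/-- The expressions `c` compute the coefficients of the polynomial `P v`, where `v` is the content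
of the index registers from `3` on. -/
def Computes (k D : ℕ) (mem : ℕ → ℝ) (c : ℕ → RExp) (P : (ℕ → ℕ) → ℝ[X]) : Prop :=
  (∀ v, (P v).natDegree ≤ k) ∧
    ∀ s, Ready k D mem s → ∀ i, (c i).eval s = (P fun x => s.idx (3 + x)).coeff i

variable {k D N : ℕ} {mem : ℕ → ℝ} {c : ℕ → RExp} {P : (ℕ → ℕ) → ℝ[X]} {s : State}

lemma computes_termSumE (a : ℕ) :
    Computes k D mem (termSumE k a N) (termSum k mem a N) := by
  refine ⟨natDegree_termSum_le a N, fun s hs i => ?_⟩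
  rw [termSumE, RExp.eval_sum, termSum, finsetSum_coeff]
  refine Finset.sum_congr rfl fun n _ => ?_
  rw [term, coeff_C_mul, termE, RExp.eval, eval_factorsE]
  simp only [RExp.eval, IExp.eval, hs.2.1, add_assoc]

lemma Computes.eval_evalE (h : Computes k D mem c P) (hs : Ready k D mem s) (e : RExp) :
    (evalE k c e).eval s = (P fun x => s.idx (3 + x)).eval (e.eval s) := by
  rw [evalE, RExp.eval_sum, eval_eq_sum_range' (Nat.lt_succ_of_le (h.1 _))]
  refine Finset.sum_congr rfl fun i _ => ?_
  rw [RExp.eval, RExp.eval_pow, h.2 s hs]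

/-- Interchanging the sums turns the trace into a combination of `k + 1` moments, so that no loop
over the spectrum is needed. -/
lemma Computes.eval_traceE (h : Computes k D mem c P) (hs : Ready k D mem s) :
    (traceE k c).eval s = trace D mem (P fun x => s.idx (3 + x)) := by
  rw [traceE, RExp.eval_sum, trace]
  simp only [eval_eq_sum_range' (Nat.lt_succ_of_le (h.1 _)), Finset.mul_sum]
  rw [Finset.sum_comm]
  refine Finset.sum_congr rfl fun i hi => ?_
  rw [RExp.eval, RExp.eval, h.2 s hs, hs.2.2 i (Nat.lt_succ_iff.1 (Finset.mem_range.1 hi)),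
    Finset.mul_sum]
  exact Finset.sum_congr rfl fun j _ => by ring

lemma computes_balanceE {u w : ℕ → RExp} {U W : (ℕ → ℕ) → ℝ[X]} (hu : Computes k D mem u U)
    (hw : Computes k D mem w W) :
    Computes k D mem (balanceE k u w) (fun v => balance D mem (U v) (W v)) := by
  refine ⟨fun v => natDegree_balance_le (hu.1 v) (hw.1 v), fun s hs i => ?_⟩
  dsimp only
  rw [balanceE, RExp.eval, RExp.eval, RExp.eval, hu.eval_traceE hs, hw.eval_traceE hs,
    hu.2 s hs, hw.2 s hs, balance, coeff_sub, coeff_C_mul, coeff_C_mul]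

end Expressions

/-! ### The exhaustive search -/

section Search

open Classical in
noncomputable def posWeight (D : ℕ) (mem : ℕ → ℝ) (p : ℝ[X]) : ℝ :=
  ∑ j ∈ Finset.range D, if 0 < p.eval (mem j) then mem (D + j) else 0

open Classical in
noncomputable def negWeight (D : ℕ) (mem : ℕ → ℝ) (p : ℝ[X]) : ℝ :=
  ∑ j ∈ Finset.range D, if p.eval (mem j) < 0 then mem (D + j) else 0

noncomputable def ratio (D : ℕ) (mem : ℕ → ℝ) (p : ℝ[X]) : ℝ :=
  1 + negWeight D mem p / posWeight D mem p

/-- The best value so far and its polynomial are in real registers `0, …, k + 1`; index register `2`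
tells whether there is one. -/
def HoldsBest (k D : ℕ) (mem : ℕ → ℝ) (s : State) : Prop :=
  (s.idx 2 = 0 ∧ s.reg 0 = 0) ∨
  (s.idx 2 = 1 ∧ trace D mem (outputPoly k s) = 0 ∧ 0 < posWeight D mem (outputPoly k s) ∧
    s.reg 0 = ratio D mem (outputPoly k s))

/-- Adds the weight of the current point to the positive or to the negative weight. -/
def countStep (k : ℕ) (c : ℕ → RExp) : Prog :=
  .ite (.realLt (.const 0) (evalE k c (.load (.var 1))))
    (.setReg (2 * k + 3) (.add (.reg (2 * k + 3)) (.load (.add (.var 0) (.var 1)))))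
    (.ite (.realLt (evalE k c (.load (.var 1))) (.const 0))
      (.setReg (2 * k + 4) (.add (.reg (2 * k + 4)) (.load (.add (.var 0) (.var 1)))))
      .skip)

/-- Computes the weights of the positive and of the negative values of the polynomial with
coefficients `c`. -/
def countProg (k : ℕ) (c : ℕ → RExp) : Prog :=
  .seq (.setReg (2 * k + 3) (.const 0)) (.seq (.setReg (2 * k + 4) (.const 0))
    (.loop 1 (countStep k c)))

def ratioE (k : ℕ) : RExp := .add (.const 1) (.div (.reg (2 * k + 4)) (.reg (2 * k + 3)))

/-- Replaces the best polynomial by the one with coefficients `c` if that is better. -/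
def updateProg (k : ℕ) (c : ℕ → RExp) : Prog :=
  .seq (countProg k c)
    (.ite (.and (.realLt (.const 0) (.reg (2 * k + 3))) (.realLt (.reg 0) (ratioE k)))
      (.seq (.setReg 0 (ratioE k)) (.seq (.assign 1 c (k + 1)) (.setIdx 2 (.const 1))))
      .skip)

/-- An upper bound for the number of steps of a program without loops. -/
def Prog.straightTime : Prog → ℕ
  | .skip => 1
  | .setIdx _ e => e.cost + 1
  | .setReg _ e => e.cost + 1
  | .store a e => a.cost + e.cost + 1
  | .seq c₁ c₂ => c₁.straightTime + c₂.straightTime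
  | .ite b c₁ c₂ => b.cost + c₁.straightTime + c₂.straightTime + 1
  | .while _ _ => 0

variable {k D : ℕ} {mem : ℕ → ℝ}

open Classical in
/-- The counters hold the weights of the positive and of the negative values of `p` at the first `n`
points; what else matters is as in `s`. -/
def Counted (k D : ℕ) (mem : ℕ → ℝ) (p : ℝ[X]) (s : State) (n : ℕ) (s' : State) : Prop :=
  s'.idx 1 = n ∧ Ready k D mem s' ∧ (∀ x ≥ 2, s'.idx x = s.idx x) ∧
    (∀ x ≤ k + 1, s'.reg x = s.reg x) ∧
    s'.reg (2 * k + 3) =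
      ∑ j ∈ Finset.range n, (if 0 < p.eval (mem j) then mem (D + j) else 0) ∧
    s'.reg (2 * k + 4) =
      ∑ j ∈ Finset.range n, (if p.eval (mem j) < 0 then mem (D + j) else 0)

lemma countStep_runs {c : ℕ → RExp} {P : (ℕ → ℕ) → ℝ[X]} (hc : Computes k D mem c P) {s s₁ : State}
    {n : ℕ} (h : Counted k D mem (P fun x => s.idx (3 + x)) s n s₁) :
    Runs (countStep k c) s₁ (countStep k c).straightTime fun s' =>
      Counted k D mem (P fun x => s.idx (3 + x)) s (n + 1)
        { s' with idx := Function.update s'.idx 1 (s'.idx 1 + 1) } := by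
  obtain ⟨h1, h2, h3, h4, h5, h6⟩ := h
  set p := P fun x => s.idx (3 + x) with hp
  have hev : (evalE k c (.load (.var 1))).eval s₁ = p.eval (mem n) := by
    rw [hc.eval_evalE h2]
    simp only [RExp.eval, IExp.eval, h1, h2.2.1, hp]
    congr 2
    ext x
    exact h3 _ (by omega)
  have hidx : ∀ x ≥ 2, Function.update s₁.idx 1 (s₁.idx 1 + 1) x = s.idx x := fun x hx => by
    rw [Function.update_of_ne (by omega), h3 x hx]
  refine Runs.ite (fun hpos => Runs.setReg ?_) fun hpos => Runs.ite
    (fun hneg => Runs.setReg ?_) fun hneg => Runs.skip ?_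
  · simp only [Test.Holds, hev, RExp.eval, Rat.cast_zero] at hpos
    refine ⟨by simp [h1], ⟨by simp [h2.1], h2.2.1, fun i hi => ?_⟩, hidx,
      fun x hx => ?_, ?_, ?_⟩
    · simp only
      rw [Function.update_of_ne (by omega), h2.2.2 i hi]
    · simp only
      rw [Function.update_of_ne (by omega), h4 x hx]
    · rw [Finset.sum_range_succ, if_pos hpos, ← h5]
      simp [RExp.eval, IExp.eval, h1, h2.1, h2.2.1]
    · rw [Finset.sum_range_succ, if_neg hpos.not_gt, ← h6]
      simp
  · simp only [Test.Holds, hev, RExp.eval, Rat.cast_zero] at hpos hneg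
    refine ⟨by simp [h1], ⟨by simp [h2.1], h2.2.1, fun i hi => ?_⟩, hidx,
      fun x hx => ?_, ?_, ?_⟩
    · simp only
      rw [Function.update_of_ne (by omega), h2.2.2 i hi]
    · simp only
      rw [Function.update_of_ne (by omega), h4 x hx]
    · rw [Finset.sum_range_succ, if_neg hpos, ← h5]
      simp
    · rw [Finset.sum_range_succ, if_pos hneg, ← h6]
      simp [RExp.eval, IExp.eval, h1, h2.1, h2.2.1]
  · simp only [Test.Holds, hev, RExp.eval, Rat.cast_zero] at hpos hneg
    refine ⟨by simp [h1], ⟨by simp [h2.1], h2.2.1, h2.2.2⟩, hidx, h4, ?_, ?_⟩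
    · rw [Finset.sum_range_succ, if_neg hpos, ← h5]
      simp
    · rw [Finset.sum_range_succ, if_neg hneg, ← h6]
      simp

lemma countProg_runs {c : ℕ → RExp} {P : (ℕ → ℕ) → ℝ[X]} (hc : Computes k D mem c P) {s : State}
    (hs : Ready k D mem s) :
    Runs (countProg k c) s (2 + (2 + (D * ((countStep k c).straightTime + 8) + 6))) fun s' =>
      Ready k D mem s' ∧ (∀ x ≥ 2, s'.idx x = s.idx x) ∧ (∀ x ≤ k + 1, s'.reg x = s.reg x) ∧
      s'.reg (2 * k + 3) = posWeight D mem (P fun x => s.idx (3 + x)) ∧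
      s'.reg (2 * k + 4) = negWeight D mem (P fun x => s.idx (3 + x)) := by
  refine Runs.seq (Runs.setReg (Q := Eq _) rfl) ?_
  rintro s₁ rfl
  refine Runs.seq (Runs.setReg (Q := Eq _) rfl) ?_
  rintro s₁ rfl
  refine (Runs.loop (Counted k D mem (P fun x => s.idx (3 + x)) s)
    (fun i s' h => ⟨h.1, h.2.1.1⟩) (fun i _ s' h => countStep_runs hc h) ?_).mono le_rfl
    fun s' h => h.2
  refine ⟨by simp, ⟨by simp [hs.1], hs.2.1, fun i hi => ?_⟩,
    fun x hx => ?_, fun x hx => ?_, by simp [RExp.eval], by simp [RExp.eval]⟩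
  · simp only
    rw [Function.update_of_ne (by omega), Function.update_of_ne (by omega), hs.2.2 i hi]
  · simp only
    rw [Function.update_of_ne (by omega)]
  · simp only
    rw [Function.update_of_ne (by omega), Function.update_of_ne (by omega)]

lemma outputPoly_eq {s : State} {p : ℝ[X]} (hp : p.natDegree ≤ k)
    (h : ∀ i < k + 1, s.reg (1 + i) = p.coeff i) : outputPoly k s = p := by
  conv_rhs => rw [p.as_sum_range_C_mul_X_pow' (Nat.lt_succ_of_le hp)]
  refine Finset.sum_congr rfl fun i hi => ?_
  rw [add_comm i, h i (Finset.mem_range.1 hi)]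

lemma HoldsBest.congr {s s' : State} (h : HoldsBest k D mem s) (h2 : s'.idx 2 = s.idx 2)
    (hreg : ∀ x ≤ k + 1, s'.reg x = s.reg x) : HoldsBest k D mem s' := by
  have : outputPoly k s' = outputPoly k s :=
    Finset.sum_congr rfl fun i hi => by
      rw [hreg _ (by have := Finset.mem_range.1 hi; omega)]
  unfold HoldsBest
  rwa [h2, hreg 0 (by omega), this]

/-- What one search step has to achieve for the polynomial `p`. -/
def Improves (k D : ℕ) (mem : ℕ → ℝ) (p : ℝ[X]) (s s' : State) : Prop :=
  (Ready k D mem s' ∧ HoldsBest k D mem s') ∧ (∀ x ≥ 3, s'.idx x = s.idx x) ∧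
    s.reg 0 ≤ s'.reg 0 ∧ (0 < posWeight D mem p → ratio D mem p ≤ s'.reg 0)

noncomputable def updateTime (k : ℕ) (c : ℕ → RExp) : ℕ[X] :=
  (2 + (2 + (X * (C (countStep k c).straightTime + 8) + 6))) +
    C (((Test.realLt (.const 0) (.reg (2 * k + 3))).and (.realLt (.reg 0) (ratioE k))).cost +
      (((ratioE k).cost + 1) + (assignTime c (k + 1) + 2)) + 1 + 1)

/-- The new coefficients may be written while `c` is still being evaluated: they go to registers `1,
…, k + 1`, whereas the value of `c` is fixed by the index registers, the memory and the moments,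
which start at register `k + 2`. -/
lemma updateProg_runs {c : ℕ → RExp} {P : (ℕ → ℕ) → ℝ[X]} (hc : Computes k D mem c P) {s : State}
    (hs : Ready k D mem s) (hb : HoldsBest k D mem s)
    (htr : trace D mem (P fun x => s.idx (3 + x)) = 0) :
    Runs (updateProg k c) s ((updateTime k c).eval D)
      (Improves k D mem (P fun x => s.idx (3 + x)) s) := by
  set p := P fun x => s.idx (3 + x) with hp
  refine Runs.mono (Runs.seq (countProg_runs hc hs) (Q := Improves k D mem p s)
    (B₂ := ((Test.realLt (.const 0) (.reg (2 * k + 3))).and (.realLt (.reg 0) (ratioE k))).cost +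
      (((ratioE k).cost + 1) + (assignTime c (k + 1) + 2)) + 1 + 1) ?_) ?_ fun _ h => h
  · rintro s₁ ⟨h1, h2, h3, h4, h5⟩
    have hratio : (ratioE k).eval s₁ = ratio D mem p := by
      simp only [ratioE, RExp.eval, h4, h5, ratio, Rat.cast_one, hp]
    refine Runs.ite (fun ht => ?_) fun ht => Runs.skip ?_
    · simp only [Test.Holds, RExp.eval, h4, hratio, Rat.cast_zero] at ht
      refine Runs.seq (Runs.setReg (Q := Eq _) rfl) ?_
      rintro s₂ rfl
      rw [hratio]
      refine Runs.seq (Runs.assign (v := p.coeff) (k + 1) ?_) ?_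
      · intro i hi s₂ hidx hmem hreg
        rw [hc.2 s₂ ⟨by rw [hidx]; exact h1.1, by rw [hmem]; exact h1.2.1, fun j hj => ?_⟩, hp]
        · congr 2
          ext x
          rw [hidx]
          exact h2 _ (by omega)
        · rw [hreg _ (by omega)]
          simp only
          rw [Function.update_of_ne (by omega), h1.2.2 j hj]
      · rintro s₂ ⟨hidx, hmem, hcoef, hreg⟩
        have h0 : s₂.reg 0 = ratio D mem p := by
          rw [hreg 0 (by omega)]
          simp
        refine Runs.setIdx ⟨⟨⟨by simp [hidx, h1.1], by simp [hmem, h1.2.1], fun j hj => ?_⟩, ?_⟩,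
          fun x hx => ?_, ?_, fun _ => ?_⟩
        · simp only
          rw [hreg _ (by omega)]
          simp only
          rw [Function.update_of_ne (by omega), h1.2.2 j hj]
        · refine Or.inr ⟨by simp [IExp.eval], ?_⟩
          change trace D mem (outputPoly k s₂) = 0 ∧ 0 < posWeight D mem (outputPoly k s₂) ∧
            s₂.reg 0 = ratio D mem (outputPoly k s₂)
          rw [outputPoly_eq (p := p) (hc.1 _) hcoef]
          exact ⟨htr, ht.1, h0⟩
        · simp only
          rw [Function.update_of_ne (by omega), hidx]
          exact h2 x (by omega)
        · simp only [h0]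
          rw [← h3 0 (by omega)]
          exact ht.2.le
        · simp only [h0]
          exact le_rfl
    · simp only [Test.Holds, RExp.eval, h4, hratio, Rat.cast_zero, not_and, not_lt] at ht
      exact ⟨⟨h1, hb.congr (h2 2 le_rfl) h3⟩, fun x hx => h2 x (by omega), (h3 0 (by omega)).ge,
        ht⟩
  · simp [updateTime]

/-- Tests the candidate described by the index registers from `3` on. -/
def testCandidate (k N : ℕ) : Prog :=
  .ite (.realEq (traceE k (termSumE k 0 N)) (.const 0)) (updateProg k (termSumE k 0 N))
    (updateProg k (balanceE k (termSumE k 0 N) (termSumE k N N)))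

noncomputable def testTime (k N : ℕ) : ℕ[X] :=
  C (Test.realEq (traceE k (termSumE k 0 N)) (.const 0)).cost + updateTime k (termSumE k 0 N) +
    updateTime k (balanceE k (termSumE k 0 N) (termSumE k N N)) + 1

lemma testCandidate_runs (N : ℕ) {s : State} (hs : Ready k D mem s) (hb : HoldsBest k D mem s) :
    Runs (testCandidate k N) s ((testTime k N).eval D)
      (Improves k D mem (candidate k N D mem fun x => s.idx (3 + x)) s) := by
  have hU := computes_termSumE (k := k) (D := D) (N := N) (mem := mem) 0
  have hW := computes_termSumE (k := k) (D := D) (N := N) (mem := mem) N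
  refine Runs.mono (Runs.ite (fun ht => ?_) fun ht => ?_)
    (B₁ := _ + (updateTime k (termSumE k 0 N)).eval D +
      (updateTime k (balanceE k (termSumE k 0 N) (termSumE k N N))).eval D + 1) ?_ fun _ h => h
  · simp only [Test.Holds, hU.eval_traceE hs, RExp.eval, Rat.cast_zero] at ht
    rw [candidate, if_pos ht]
    exact updateProg_runs hU hs hb ht
  · simp only [Test.Holds, hU.eval_traceE hs, RExp.eval, Rat.cast_zero] at ht
    rw [candidate, if_neg ht]
    exact updateProg_runs (computes_balanceE hU hW) hs hb (trace_balance _ _)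
  · simp [testTime]

def momentStep (k i : ℕ) : RExp :=
  .add (.reg (k + 2 + i)) (.mul (.load (.add (.var 0) (.var 1))) ((RExp.load (.var 1)).pow i))

/-- One pass over the spectrum accumulates all moments; `hr` provides the empty sums to start from.
-/
lemma moments_run {s : State} (h0 : s.idx 0 = D) (hm : s.mem = mem) (hr : s.reg = fun _ => 0) :
    Runs (.loop 1 (.assign (k + 2) (momentStep k) (k + 1))) s
      (D * (assignTime (momentStep k) (k + 1) + 8) + 6) fun s' =>
        Ready k D mem s' ∧ s'.idx 2 = s.idx 2 ∧ s'.reg 0 = 0 := by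
  refine (Runs.loop (D := D) (fun n s' => s'.idx 1 = n ∧ s'.idx 0 = D ∧ s'.mem = mem ∧
    s'.idx 2 = s.idx 2 ∧ s'.reg 0 = 0 ∧
    ∀ i ≤ k, s'.reg (k + 2 + i) = ∑ j ∈ Finset.range n, mem (D + j) * mem j ^ i)
    (fun n s' h => ⟨h.1, h.2.1⟩) ?_ ?_).mono le_rfl ?_
  · rintro n hn s₁ ⟨h1, h2, h3, h4, h5, h6⟩
    refine (Runs.assign (v := fun i => ∑ j ∈ Finset.range (n + 1), mem (D + j) * mem j ^ i)
      (k + 1) ?_).mono le_rfl ?_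
    · intro i hi s₂ hidx hmem hreg
      simp only [momentStep, RExp.eval, RExp.eval_pow, IExp.eval, hidx, hmem, h1, h2, h3]
      rw [hreg _ (by omega), h6 i (by omega), Finset.sum_range_succ]
    · rintro s₂ ⟨hidx, hmem, hv, hreg⟩
      exact ⟨by simp [hidx, h1], by simp [hidx, h2], by simp [hmem, h3], by simp [hidx, h4],
        by rw [← h5]; exact hreg 0 (by omega), fun i hi => hv i (by omega)⟩
  · exact ⟨by simp, by simp [h0], hm, by simp, by simp [hr], fun i _ => by simp [hr]⟩
  · rintro s' ⟨-, h2, h3, h4, h5, h6⟩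
    exact ⟨⟨h2, h3, h6⟩, h4, h5⟩

/-- The program tries all candidates. -/
def searchProg (k : ℕ) : Prog :=
  .seq (.loop 1 (.assign (k + 2) (momentStep k) (k + 1)))
    (.seq (.nest (testCandidate k (2 ^ k)) (2 * 2 ^ k * (k + 2))) (.setIdx 0 (.var 2)))

/-- Each nested loop raises the degree by one, and the number of loops depends on `k` only. -/
noncomputable def searchTime (k : ℕ) : ℕ[X] :=
  (X * (C (assignTime (momentStep k) (k + 1)) + 8) + 6) +
    ((fun T : ℕ[X] => X * (T + 8) + 6)^[2 * 2 ^ k * (k + 2)] (testTime k (2 ^ k)) + 2)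

end Search

/-! ### From the memory contents back to the graph -/

section Spectrum

universe u

variable {V : Type u} [Fintype V] [DecidableEq V] (G : SimpleGraph V) [DecidableRel G.Adj]

/-- The number of distinct eigenvalues. -/
noncomputable abbrev numDistinct : ℕ := (distinctEigenvalues G).length

/-- The memory that holds the spectral input. -/
noncomputable abbrev spectralMem : ℕ → ℝ := (spectralInput G).mem

lemma length_distinctEigenvalues_le : numDistinct G ≤ Fintype.card V := by
  rw [numDistinct, distinctEigenvalues, Finset.length_sort]
  exact Finset.card_image_le

lemma spectralInput_mem {j : ℕ} (hj : j < numDistinct G) :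
    spectralMem G j = (distinctEigenvalues G)[j] := by
  simp only [spectralMem, spectralInput]
  rw [List.getD_append _ _ _ _ hj, List.getD_eq_getElem _ _ hj]

lemma spectralInput_mem_add {j : ℕ} (hj : j < numDistinct G) :
    spectralMem G (numDistinct G + j) = eigMult G (spectralMem G j) := by
  rw [spectralInput_mem G hj]
  simp only [spectralMem, numDistinct, spectralInput]
  rw [List.getD_append_right _ _ _ _ (Nat.le_add_right _ _), Nat.add_sub_cancel_left,
    List.getD_eq_getElem _ _ (by simpa using hj), List.getElem_map]

lemma image_spectralInput_mem : Finset.univ.image (eigenvalue G) =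
    (Finset.range (numDistinct G)).image (spectralMem G) := by
  ext x
  rw [← Finset.mem_sort (· ≥ ·), ← distinctEigenvalues, List.mem_iff_getElem, Finset.mem_image]
  constructor
  · rintro ⟨j, hj, rfl⟩
    exact ⟨j, Finset.mem_range.2 hj, spectralInput_mem G hj⟩
  · rintro ⟨j, hj, rfl⟩
    exact ⟨j, Finset.mem_range.1 hj, (spectralInput_mem G _).symm⟩

/-- Groups equal eigenvalues; the list of distinct ones has no repetitions. Taking `f` to be `p` or
the indicator of one of its signs translates the trace and both inertia counts. -/
lemma sum_eigenvalue (f : ℝ → ℝ) : ∑ i : V, f (eigenvalue G i) =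
    ∑ j ∈ Finset.range (numDistinct G),
      spectralMem G (numDistinct G + j) * f (spectralMem G j) := by
  rw [Finset.sum_comp f (eigenvalue G), image_spectralInput_mem, Finset.sum_image]
  · refine Finset.sum_congr rfl fun j hj => ?_
    rw [spectralInput_mem_add G (Finset.mem_range.1 hj), nsmul_eq_mul, eigMult,
      Nat.card_eq_fintype_card, Fintype.card_subtype]
  · intro i hi j hj h
    have hi := Finset.mem_range.1 hi
    have hj := Finset.mem_range.1 hj
    rw [spectralInput_mem G hi, spectralInput_mem G hj] at h
    exact (List.Nodup.getElem_inj_iff (Finset.sort_nodup _ _)).1 h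

lemma trace_spectralInput (p : ℝ[X]) : trace (numDistinct G) (spectralMem G) p =
    ∑ i : V, p.eval (eigenvalue G i) :=
  (sum_eigenvalue G fun x => p.eval x).symm

lemma posWeight_spectralInput (p : ℝ[X]) :
    posWeight (numDistinct G) (spectralMem G) p = nPos G p := by
  classical
  have := sum_eigenvalue G fun x => if 0 < p.eval x then 1 else 0
  simp only [mul_ite, mul_one, mul_zero] at this
  rw [posWeight, nPos, Nat.card_eq_fintype_card, Fintype.card_subtype, Finset.card_filter]
  push_cast
  exact this.symm

lemma negWeight_spectralInput (p : ℝ[X]) :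
    negWeight (numDistinct G) (spectralMem G) p = nNeg G p := by
  classical
  have := sum_eigenvalue G fun x => if p.eval x < 0 then 1 else 0
  simp only [mul_ite, mul_one, mul_zero] at this
  rw [negWeight, nNeg, Nat.card_eq_fintype_card, Fintype.card_subtype, Finset.card_filter]
  push_cast
  exact this.symm

lemma ratio_spectralInput (p : ℝ[X]) : ratio (numDistinct G) (spectralMem G) p = objective G p := by
  rw [ratio, objective, posWeight_spectralInput, negWeight_spectralInput]

lemma admissible_iff (k : ℕ) (p : ℝ[X]) :
    Admissible G k p ↔ p.degree ≤ k ∧ trace (numDistinct G) (spectralMem G) p = 0 ∧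
      0 < posWeight (numDistinct G) (spectralMem G) p := by
  rw [Admissible, trace_spectralInput, posWeight_spectralInput, Nat.cast_pos, Nat.pos_iff_ne_zero]

/-- A positive value and sum zero force a negative value, at a different eigenvalue. This gives the
two points of `Θ` that the decomposition needs. -/
lemma Admissible.one_lt_card {k : ℕ} {p : ℝ[X]} (h : Admissible G k p) :
    1 < (Finset.univ.image (eigenvalue G)).card := by
  obtain ⟨-, hsum, hpos⟩ := h
  obtain ⟨⟨a, ha⟩⟩ := (Nat.card_ne_zero.1 hpos).1
  obtain ⟨b, -, hb⟩ : ∃ b ∈ Finset.univ, p.eval (eigenvalue G b) < 0 := by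
    by_contra! hcon
    exact ha.ne' ((Finset.sum_eq_zero_iff_of_nonneg hcon).1 hsum a (Finset.mem_univ a))
  refine Finset.one_lt_card.2 ⟨_, Finset.mem_image_of_mem _ (Finset.mem_univ a), _,
    Finset.mem_image_of_mem _ (Finset.mem_univ b), fun hab => ?_⟩
  rw [hab] at ha
  exact ha.not_gt hb

lemma degree_outputPoly_le (k : ℕ) (s : State) : (outputPoly k s).degree ≤ k := by
  rw [← natDegree_le_iff_degree_le]
  refine natDegree_sum_le_of_forall_le _ _ fun i hi => ?_
  exact (natDegree_C_mul_X_pow_le _ _).trans (Nat.lt_succ_iff.1 (Finset.mem_range.1 hi))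

/-- Every admissible polynomial is matched by a candidate. -/
lemma Admissible.exists_candidate {k : ℕ} {p : ℝ[X]} (h : Admissible G k p) :
    ∃ v : ℕ → ℕ, (∀ i, v i < numDistinct G) ∧
      0 < posWeight (numDistinct G) (spectralMem G)
        (candidate k (2 ^ k) (numDistinct G) (spectralMem G) v) ∧
      ratio (numDistinct G) (spectralMem G)
        (candidate k (2 ^ k) (numDistinct G) (spectralMem G) v) = objective G p := by
  have htr := (admissible_iff G k p).1 h
  obtain ⟨v, hv, hs⟩ := PolyInertia.exists_candidate (image_spectralInput_mem G) h.one_lt_card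
    h.1 htr.2.1
  have hmem : ∀ i : V, eigenvalue G i ∈ Finset.univ.image (eigenvalue G) := fun i =>
    Finset.mem_image_of_mem _ (Finset.mem_univ i)
  have hp : nPos G (candidate k (2 ^ k) (numDistinct G) (spectralMem G) v) = nPos G p :=
    Nat.card_congr (Equiv.subtypeEquivRight fun i => (hs _ (hmem i)).1)
  have hn : nNeg G (candidate k (2 ^ k) (numDistinct G) (spectralMem G) v) = nNeg G p :=
    Nat.card_congr (Equiv.subtypeEquivRight fun i => (hs _ (hmem i)).2)
  refine ⟨v, hv, ?_, ?_⟩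
  · rw [posWeight_spectralInput, hp, ← posWeight_spectralInput]
    exact htr.2.2
  · rw [ratio_spectralInput, objective, objective, hp, hn]

/-- The stored value bounds the ratio of every candidate with positive weight, hence the objective
at every admissible polynomial. If the flag is set, the stored polynomial attains that bound, so the
maximum exists. -/
lemma searchProg_runs (k : ℕ) : Runs (searchProg k) (spectralInput G)
    ((searchTime k).eval (numDistinct G)) (SolvesPolyInertia G k) := by
  refine Runs.mono (Runs.seq (moments_run (D := numDistinct G) (mem := spectralMem G) (k := k)
    (by simp [spectralInput]) rfl rfl) fun s₁ hs₁ => Runs.seq (Runs.nest (D := numDistinct G) (testTime k (2 ^ k)) rfl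
      (fun s => Ready k (numDistinct G) (spectralMem G) s ∧
        HoldsBest k (numDistinct G) (spectralMem G) s)
      (fun v b => 0 < posWeight (numDistinct G) (spectralMem G)
          (candidate k (2 ^ k) (numDistinct G) (spectralMem G) v) →
        ratio (numDistinct G) (spectralMem G)
          (candidate k (2 ^ k) (numDistinct G) (spectralMem G) v) ≤ b)
      (fun v b b' h hb hpos => (h hpos).trans hb) ?_ (fun s h => h.1.1)
      (fun s h => testCandidate_runs (2 ^ k) h.1 h.2) (2 * 2 ^ k * (k + 2)) s₁ ?_)
      fun s₂ hs₂ => Runs.setIdx ?_) ?_ fun _ h => h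
  · rintro s x i hx ⟨h1, h2⟩
    refine ⟨⟨?_, h1.2⟩, h2.congr ?_ fun _ _ => rfl⟩
    · simp only
      rw [Function.update_of_ne (by omega), h1.1]
    · simp only
      rw [Function.update_of_ne (by omega)]
  · refine ⟨hs₁.1, Or.inl ⟨?_, hs₁.2.2⟩⟩
    rw [hs₁.2.1]
    simp [spectralInput]
  · obtain ⟨⟨-, hbest⟩, -, -, hdone⟩ := hs₂
    have hle : ∀ p, Admissible G k p → objective G p ≤ s₂.reg 0 := by
      intro p hp
      obtain ⟨v, hv, hpos, hr⟩ := hp.exists_candidate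
      have hcongr := candidate_congr (k := k) (N := 2 ^ k) (D := numDistinct G)
        (mem := spectralMem G) (v := v)
        (v' := fun i => if i < 2 * 2 ^ k * (k + 2) then v i else s₁.idx (3 + i))
        fun i hi => (if_pos hi).symm
      rw [hcongr] at hpos hr
      rw [← hr]
      exact hdone _ (fun i hi => (if_pos hi).trans_lt (hv i)) (fun i hi => if_neg hi.not_gt) hpos
    rcases hbest with ⟨h2, h0⟩ | ⟨h2, htr, hpos, h0⟩
    -- With no polynomial stored, the bound is still the initial `0`, but every objective value is
    -- at least `1`.
    · refine Or.inl ⟨by simp [IExp.eval, h2], fun p hp => ?_⟩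
      have h1 := hle p hp
      have : 0 ≤ (nNeg G p : ℝ) / nPos G p := by positivity
      rw [h0, objective] at h1
      linarith
    · have hadm : Admissible G k (outputPoly k s₂) :=
        (admissible_iff G k _).2 ⟨degree_outputPoly_le k s₂, htr, hpos⟩
      rw [ratio_spectralInput] at h0
      refine Or.inr ⟨by simp [IExp.eval, h2], ⟨⟨_, hadm, h0.symm⟩, ?_⟩, hadm, h0.symm⟩
      rintro _ ⟨p, hp, rfl⟩
      exact hle p hp
  · simp [searchTime, IExp.cost]

end Spectrum

/-- Passes from a time bound in the number of distinct eigenvalues to one in `n`. -/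
lemma eval_mono (T : ℕ[X]) : Monotone fun n => T.eval n := by
  intro m n h
  simp only [eval_eq_sum_range]
  gcongr

end PolyInertia

theorem mainTheorem2 (k : ℕ) :
    ∃ (c : PolyInertia.Prog) (T : Polynomial ℕ),
      ∀ (V : Type*) [Fintype V] [DecidableEq V] (G : SimpleGraph V) [DecidableRel G.Adj],
        PolyInertia.PartiallyWalkRegular G k →
          ∃ (t : ℕ) (s : PolyInertia.State),
            PolyInertia.Exec c (PolyInertia.spectralInput G) t s ∧
            t ≤ T.eval (Fintype.card V) ∧
            PolyInertia.SolvesPolyInertia G k s := by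
  refine ⟨PolyInertia.searchProg k, PolyInertia.searchTime k, fun V _ _ G _ _ => ?_⟩
  exact (PolyInertia.searchProg_runs G k).mono
    (PolyInertia.eval_mono _ (PolyInertia.length_distinctEigenvalues_le G)) fun _ h => h
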